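/- **Conventions.** For a finite monoid $M$ let $x\,\mathcal L\,y\iff Mx=My$, $x\,\mathcal R\,y\iff xM=yM$, $\mathcal H=\mathcal L\cap\mathcal R$, and $x\,\mathcal D\,y\iff x\,\mathcal L\,z$ and $z\,\mathcal R\,y$ for some $z\in M$; write $H_x$ for the $\mathcal H$-class of $x$. $M$ is *regular* if for every $x\in M$ there is $y\in M$ with $x=xyx$. For every $\mathcal D$-class $D$ fix a base element $\gamma_D\in D$ and let $H=H_{\gamma_D}$; the *Schützenberger group* $G_D$ is the group of the maps $r_m:H\to H$, $h\mapsto hm$, for those $m\in M$ with $Hm\subseteq H$, with product $r_mr_n=r_{mn}$. A *twisting* on $M$ with values in a field $k$ is a map $\pi:M\times M\to k$ with $\pi(x,y)\pi(xy,z)=\pi(x,yz)\pi(y,z)$ and $\pi(x,1)=1=\pi(1,x)$ for all $x,y,z\in M$. It is *strongly compatible* if for all $a,x\in M$: (1) if $ax\,\mathcal D\,x$, then $\pi(a,y)=\pi(a,x)\neq0$ for all $y\in H_x$; (2) if $xa\,\mathcal D\,x$, then $\pi(y,a)=\pi(x,a)\neq0$ for all $y\in H_x$. The *twisted monoid algebra*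 $k^\pi[M]$ is the $k$-vector space with basis $M$ and the multiplication determined by $x\circ y=\pi(x,y)\,xy$ for $x,y\in M$. A *cell algebra* structure on a unital associative $k$-algebra $A$ consists of a finite poset $\Lambda$, finite sets $L(\lambda),R(\lambda)$ for $\lambda\in\Lambda$, and a $k$-basis $\{{}_sC^\lambda_t:\lambda\in\Lambda,\ s\in L(\lambda),\ t\in R(\lambda)\}$ of $A$ (indexed injectively) such that, with $\hat A^\lambda=\operatorname{span}\{{}_sC^\mu_t:\mu>\lambda\}$, for all $a\in A$, $\lambda\in\Lambda$: (i) there are scalars $r_L(s,s')$ (depending on $a,\lambda$) with $a\cdot{}_sC^\lambda_t\equiv\sum_{s'\in L(\lambda)}r_L(s,s')\,{}_{s'}C^\lambda_t \bmod \hat A^\lambda$ for all $s,t$; (ii) there are scalars $r_R(t,t')$ (depending on $a,\lambda$) with ${}_sC^\lambda_t\cdot a\equiv\sum_{t'\in R(\lambda)}r_R(t,t')\,{}_sC^\lambda_{t'} \bmod \hat A^\lambda$ for all $s,t$. Let $C^\lambda_R$ and ${}_LC^\lambda$ be the vector spaces with bases $\{C^\lambda_t:t\in R(\lambda)\}$ and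 $\{{}_sC^\lambda:s\in L(\lambda)\}$, let $\langle-,-\rangle:C_R^\lambda\times{}_LC^\lambda\to k$ be the bilinear map determined by ${}_{s'}C^\lambda_t\cdot{}_sC^\lambda_{t'}\equiv\langle C^\lambda_t,{}_sC^\lambda\rangle\,{}_{s'}C^\lambda_{t'}\bmod\hat A^\lambda$ for all $s',t'$, and let $\Lambda_0$ be the set of all $\lambda\in\Lambda$ with $\langle x,y\rangle\ne0$ for some $x\in C_R^\lambda$, $y\in{}_LC^\lambda$. A finite-dimensional $k$-algebra $A$ is *quasi-hereditary* if there is a chain $0=J_0\subset J_1\subset\dots\subset J_n=A$ of two-sided ideals such that, for $0\le i<n$, $J=J_{i+1}/J_i$ is a heredity ideal of $B=A/J_i$, that is, $J^2=J$, $J\cdot\operatorname{rad}(B)\cdot J=0$, and $J$ is projective as a left $B$-module. **Proposition.** Let $k$ be a field, $M$ a regular finite monoid, and $\pi$ a strongly compatible twisting on $M$ with values in $k$. Assume that for every $\mathcal D$-class $D$ of $M$ the group algebra $k[G_D]$ is given a cell algebra structure, with poset $\Lambda_D$, such that $(\Lambda_D)_0=\Lambda_D$. Then the twisted monoid algebra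 $k^\pi[M]$ is quasi-hereditary. -/

import Mathlib

universe w u v

/-! ## Green's relations on a monoid -/

/-- Green's relation `𝓛`: `x 𝓛 y` iff `M x = M y`. -/
def GreenL {M : Type*} [Monoid M] (x y : M) : Prop :=
  Set.range (fun m : M => m * x) = Set.range (fun m : M => m * y)

/-- Green's relation `𝓡`: `x 𝓡 y` iff `x M = y M`. -/
def GreenR {M : Type*} [Monoid M] (x y : M) : Prop :=
  Set.range (fun m : M => x * m) = Set.range (fun m : M => y * m)

/-- Green's relation `𝓗`: both `x 𝓛 y` and `x 𝓡 y`. -/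
def GreenH {M : Type*} [Monoid M] (x y : M) : Prop :=
  GreenL x y ∧ GreenR x y

/-- Green's relation `𝓓`: `x 𝓛 z` and `z 𝓡 y` for some `z`. -/
def GreenD {M : Type*} [Monoid M] (x y : M) : Prop :=
  ∃ z : M, GreenL x z ∧ GreenR z y

theorem greenL_iff {M : Type*} [Monoid M] {x y : M} :
    GreenL x y ↔ (∃ a, a * y = x) ∧ ∃ b, b * x = y := by
  constructor
  · intro h
    have h1 : x ∈ Set.range (fun m : M => m * y) := by
      have : x ∈ Set.range (fun m : M => m * x) := ⟨1, one_mul x⟩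
      rwa [h] at this
    have h2 : y ∈ Set.range (fun m : M => m * x) := by
      have : y ∈ Set.range (fun m : M => m * y) := ⟨1, one_mul y⟩
      rwa [← h] at this
    exact ⟨h1, h2⟩
  · rintro ⟨⟨a, rfl⟩, b, hb⟩
    apply Set.Subset.antisymm
    · rintro _ ⟨m, rfl⟩
      exact ⟨m * a, by simp [mul_assoc]⟩
    · rintro _ ⟨m, rfl⟩
      refine ⟨m * b, ?_⟩
      change m * b * (a * y) = m * y
      rw [mul_assoc, hb]

theorem greenR_iff {M : Type*} [Monoid M] {x y : M} :
    GreenR x y ↔ (∃ a, y * a = x) ∧ ∃ b, x * b = y := by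
  constructor
  · intro h
    have h1 : x ∈ Set.range (fun m : M => y * m) := by
      have : x ∈ Set.range (fun m : M => x * m) := ⟨1, mul_one x⟩
      rwa [h] at this
    have h2 : y ∈ Set.range (fun m : M => x * m) := by
      have : y ∈ Set.range (fun m : M => y * m) := ⟨1, mul_one y⟩
      rwa [← h] at this
    exact ⟨h1, h2⟩
  · rintro ⟨⟨a, rfl⟩, b, hb⟩
    apply Set.Subset.antisymm
    · rintro _ ⟨m, rfl⟩
      exact ⟨a * m, by simp [mul_assoc]⟩
    · rintro _ ⟨m, rfl⟩
      refine ⟨b * m, ?_⟩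
      change y * a * (b * m) = y * m
      rw [← mul_assoc, hb]

/-- `𝓛` and `𝓡` commute. -/
theorem greenLR_comm {M : Type*} [Monoid M] {x y : M} :
    (∃ z, GreenL x z ∧ GreenR z y) ↔ ∃ z, GreenR x z ∧ GreenL z y := by
  constructor
  · rintro ⟨z, h1, h2⟩
    obtain ⟨⟨b, hb⟩, a, ha⟩ := greenL_iff.1 h1
    obtain ⟨⟨d, hd⟩, c, hc⟩ := greenR_iff.1 h2
    refine ⟨x * c, greenR_iff.2 ⟨⟨d, ?_⟩, c, rfl⟩, greenL_iff.2 ⟨⟨b, ?_⟩, a, ?_⟩⟩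
    · rw [← hb, mul_assoc b, hc, mul_assoc, hd]
    · rw [← hb, mul_assoc, hc]
    · rw [← mul_assoc, ha, hc]
  · rintro ⟨z, h1, h2⟩
    obtain ⟨⟨d, hd⟩, c, hc⟩ := greenR_iff.1 h1
    obtain ⟨⟨b, hb⟩, a, ha⟩ := greenL_iff.1 h2
    refine ⟨a * x, greenL_iff.2 ⟨⟨b, ?_⟩, a, rfl⟩, greenR_iff.2 ⟨⟨d, ?_⟩, c, ?_⟩⟩
    · rw [← hd, ← mul_assoc a, ha, ← mul_assoc, hb]
    · rw [← ha, mul_assoc, hd]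
    · rw [mul_assoc, hc, ha]

theorem greenD_equivalence {M : Type*} [Monoid M] : Equivalence (GreenD (M := M)) where
  refl x := ⟨x, rfl, rfl⟩
  symm := by
    rintro x y ⟨z, h1, h2⟩
    exact greenLR_comm.2 ⟨z, Eq.symm h2, Eq.symm h1⟩
  trans := by
    rintro x y w ⟨z, h1, h2⟩ h
    obtain ⟨v, h3, h4⟩ := greenLR_comm.1 h
    obtain ⟨u, h5, h6⟩ := greenLR_comm.2 ⟨v, Eq.trans h2 h3, h4⟩
    exact ⟨u, Eq.trans h1 h5, h6⟩

/-- The equivalence relation `𝓓`. -/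
def greenDSetoid (M : Type*) [Monoid M] : Setoid M := ⟨GreenD, greenD_equivalence⟩

/-- The set of `𝓓`-classes of `M`. -/
def DClass (M : Type*) [Monoid M] : Type _ := Quotient (greenDSetoid M)

/-- The `𝓓`-class of an element. -/
def DClass.mk {M : Type*} [Monoid M] (x : M) : DClass M := Quotient.mk (greenDSetoid M) x

/-- A monoid is regular if every `x` can be written as `x y x`. -/
def IsRegularMonoid (M : Type*) [Monoid M] : Prop := ∀ x : M, ∃ y : M, x = x * y * x

/-! ## The (right) Schützenberger group -/

/-- The `𝓗`-class of `γ`. -/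
def HClass {M : Type*} [Monoid M] (γ : M) : Set M := {h | GreenH h γ}

/-- `RT(H) = {m : H m ⊆ H}` for the `𝓗`-class `H` of `γ`. -/
def RT {M : Type*} [Monoid M] (γ : M) : Submonoid M where
  carrier := {m | ∀ h ∈ HClass γ, h * m ∈ HClass γ}
  one_mem' := fun h hh => by rwa [mul_one]
  mul_mem' := fun {a b} ha hb h hh => by
    rw [← mul_assoc]
    exact hb _ (ha h hh)

/-- The right translation `H → H`, `h ↦ h m`, for `m ∈ RT(H)`. -/
def rightTranslation {M : Type*} [Monoid M] (γ : M) (m : RT γ) : HClass γ → HClass γ :=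
  fun h => ⟨h * m, m.2 h h.2⟩

theorem rightTranslation_bijective {M : Type*} [Monoid M] [Finite M] (γ : M) (m : RT γ) :
    Function.Bijective (rightTranslation γ m) := by
  apply Finite.injective_iff_bijective.1
  have hγ : GreenH (γ * (m : M)) γ := m.2 γ ⟨rfl, rfl⟩
  obtain ⟨-, w, hw⟩ := greenR_iff.1 hγ.2
  have key : ∀ h : HClass γ, (h : M) * m * w = h := by
    rintro ⟨h, hh⟩
    obtain ⟨⟨u, rfl⟩, -⟩ := greenL_iff.1 hh.1
    change u * γ * m * w = u * γ
    rw [mul_assoc u, mul_assoc u, hw]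
  intro h h' e
  have e1 : (h : M) * m = h' * m := congrArg Subtype.val e
  exact Subtype.ext (by rw [← key h, e1, key h'])

/-- The permutation `r_m` of `H`. Permutations of `H` are composed from left to right (as maps
written on the right of their argument), so that `r_m r_n = r_{mn}`: this is multiplication in the
opposite of `Equiv.Perm H`. -/
noncomputable def rPerm {M : Type*} [Monoid M] [Finite M] (γ : M) :
    RT γ →* (Equiv.Perm (HClass γ))ᵐᵒᵖ where
  toFun m := MulOpposite.op (Equiv.ofBijective _ (rightTranslation_bijective γ m))
  map_one' := by
    apply MulOpposite.unop_injective
    ext h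
    simp [rightTranslation]
  map_mul' m n := by
    apply MulOpposite.unop_injective
    ext h
    simp [rightTranslation, mul_assoc]

/-- The (right) Schützenberger group `{r_m : m ∈ RT(H)}` of the `𝓗`-class `H` of `γ`. -/
noncomputable def SchutzenbergerGroup {M : Type*} [Monoid M] [Finite M] (γ : M) :
    Subgroup (Equiv.Perm (HClass γ))ᵐᵒᵖ where
  carrier := Set.range (rPerm γ)
  one_mem' := ⟨1, map_one _⟩
  mul_mem' := by
    rintro _ _ ⟨m, rfl⟩ ⟨n, rfl⟩
    exact ⟨m * n, map_mul _ _ _⟩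
  inv_mem' := by
    rintro _ ⟨m, rfl⟩
    refine ⟨m ^ (orderOf (rPerm γ m) - 1), ?_⟩
    have : Finite (Equiv.Perm (HClass γ))ᵐᵒᵖ := Finite.of_equiv _ MulOpposite.opEquiv
    rw [map_pow]
    apply eq_inv_of_mul_eq_one_left
    rw [← pow_succ, Nat.sub_add_cancel (orderOf_pos _), pow_orderOf_eq_one]

/-! ## Cell algebras -/

/-- A cell algebra structure on a unital associative `R`-algebra `A`: a finite poset `Λ`, finite
sets `L l` and `Rt l` of left and right indices, and a basis `C l s t` of `A` satisfying the two
cell conditions. -/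
structure CellStructure (R : Type u) (A : Type v) [CommRing R] [Ring A] [Algebra R A] where
  Λ : Type w
  [partialOrder : PartialOrder Λ]
  [finite : Finite Λ]
  L : Λ → Type w
  Rt : Λ → Type w
  [fintypeL : ∀ l, Fintype (L l)]
  [fintypeRt : ∀ l, Fintype (Rt l)]
  basis : Module.Basis (Σ l : Λ, L l × Rt l) R A
  /-- (i) `a · C l s t = ∑ s', r s s' · C l s' t` modulo the span of the `C μ _ _` with `μ > l`,
  with coefficients independent of `t`. -/
  left_cell : ∀ (a : A) (l : Λ), ∃ r : L l → L l → R, ∀ (s : L l) (t : Rt l),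
    a * basis ⟨l, s, t⟩ - ∑ s' : L l, r s s' • basis ⟨l, s', t⟩ ∈
      Submodule.span R {x : A | ∃ μ : Λ, l < μ ∧ ∃ (s' : L μ) (t' : Rt μ), x = basis ⟨μ, s', t'⟩}
  /-- (ii) `C l s t · a = ∑ t', r t t' · C l s t'` modulo the span of the `C μ _ _` with `μ > l`,
  with coefficients independent of `s`. -/
  right_cell : ∀ (a : A) (l : Λ), ∃ r : Rt l → Rt l → R, ∀ (s : L l) (t : Rt l),
    basis ⟨l, s, t⟩ * a - ∑ t' : Rt l, r t t' • basis ⟨l, s, t'⟩ ∈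
      Submodule.span R {x : A | ∃ μ : Λ, l < μ ∧ ∃ (s' : L μ) (t' : Rt μ), x = basis ⟨μ, s', t'⟩}

namespace CellStructure

attribute [instance] CellStructure.partialOrder CellStructure.finite CellStructure.fintypeL
  CellStructure.fintypeRt

/-- The cell basis element `_s C_t^l`. -/
noncomputable def C {R A : Type*} [CommRing R] [Ring A] [Algebra R A] (S : CellStructure R A)
    (l : S.Λ) (s : S.L l) (t : S.Rt l) : A := S.basis ⟨l, s, t⟩

/-- `Â^l`, the span of the cell basis elements belonging to the `μ > l`. -/
def strictUpper {R A : Type*} [CommRing R] [Ring A] [Algebra R A] (S : CellStructure R A)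
    (l : S.Λ) : Submodule R A :=
  Submodule.span R
    {x : A | ∃ μ : S.Λ, l < μ ∧ ∃ (s : S.L μ) (t : S.Rt μ), x = S.C μ s t}

theorem coord_strictUpper {R A : Type*} [CommRing R] [Ring A] [Algebra R A]
    (S : CellStructure R A) (l : S.Λ) (s : S.L l) (t : S.Rt l) {x : A}
    (hx : x ∈ S.strictUpper l) : S.basis.coord ⟨l, s, t⟩ x = 0 := by
  classical
  have h : S.strictUpper l ≤ LinearMap.ker (S.basis.coord ⟨l, s, t⟩) := by
    rw [strictUpper, Submodule.span_le]
    rintro _ ⟨μ, hμ, s', t', rfl⟩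
    have hne : (⟨μ, s', t'⟩ : Σ l : S.Λ, S.L l × S.Rt l) ≠ ⟨l, s, t⟩ := by
      intro e
      exact hμ.ne' (congrArg Sigma.fst e)
    simp [C, hne]
  exact h hx

/-- The structure constants of the bracket on the cell modules at `l`: there is a scalar
`g t s`, with `_{s'}C_t · _sC_{t'} = g t s · _{s'}C_{t'}` modulo `Â^l` for all `s'` and `t'`. -/
theorem exists_gram {R A : Type*} [CommRing R] [Ring A] [Algebra R A]
    (S : CellStructure R A) (l : S.Λ) :
    ∃ g : S.Rt l → S.L l → R, ∀ (s' : S.L l) (t : S.Rt l) (s : S.L l) (t' : S.Rt l),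
      S.C l s' t * S.C l s t' - g t s • S.C l s' t' ∈ S.strictUpper l := by
  classical
  choose X hX using fun (s' : S.L l) (t : S.Rt l) => S.left_cell (S.C l s' t) l
  choose Y hY using fun (s : S.L l) (t' : S.Rt l) => S.right_cell (S.C l s t') l
  have hdiff : ∀ s' t s t', (∑ t'' : S.Rt l, Y s t' t t'' • S.C l s' t'') -
      ∑ s'' : S.L l, X s' t s s'' • S.C l s'' t' ∈ S.strictUpper l := by
    intro s' t s t'
    have h := (S.strictUpper l).sub_mem (hX s' t s t') (hY s t' s' t)
    convert h using 1
    simp [C]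
  have hcoord : ∀ s' t s t' s'', (if s'' = s' then Y s t' t t' else 0) = X s' t s s'' := by
    intro s' t s t' s''
    have h := S.coord_strictUpper l s'' t' (hdiff s' t s t')
    rw [map_sub, map_sum, map_sum, sub_eq_zero] at h
    rw [Finset.sum_eq_single t', Finset.sum_eq_single s''] at h
    · simpa [C, Finsupp.single_apply, eq_comm] using h
    · intro b _ hb
      simp [C, hb]
    · simp
    · intro b _ hb
      simp [C, hb]
    · simp
  have hmain : ∀ s' t s t',
      S.C l s' t * S.C l s t' - Y s t' t t' • S.C l s' t' ∈ S.strictUpper l := by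
    intro s' t s t'
    have h := hX s' t s t'
    rw [Finset.sum_eq_single s'] at h
    · rw [← hcoord s' t s t' s', if_pos rfl] at h
      exact h
    · intro b _ hb
      rw [← hcoord s' t s t' b, if_neg hb, zero_smul]
    · simp
  rcases isEmpty_or_nonempty (S.Rt l) with hR | ⟨⟨t₀⟩⟩
  · exact ⟨fun _ _ => 0, fun _ t => hR.elim t⟩
  · refine ⟨fun t s => Y s t₀ t t₀, fun s' t s t' => ?_⟩
    have e1 := hcoord s' t s t' s'
    have e2 := hcoord s' t s t₀ s'
    rw [if_pos rfl] at e1 e2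
    change S.C l s' t * S.C l s t' - Y s t₀ t t₀ • S.C l s' t' ∈ _
    rw [e2, ← e1]
    exact hmain s' t s t'

/-- The bracket of basis vectors, `⟨C_t^l, _sC^l⟩`. -/
noncomputable def gram {R A : Type*} [CommRing R] [Ring A] [Algebra R A]
    (S : CellStructure R A) (l : S.Λ) : S.Rt l → S.L l → R :=
  Classical.choose (S.exists_gram l)

theorem gram_spec {R A : Type*} [CommRing R] [Ring A] [Algebra R A]
    (S : CellStructure R A) (l : S.Λ) (s' : S.L l) (t : S.Rt l) (s : S.L l) (t' : S.Rt l) :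
    S.C l s' t * S.C l s t' - S.gram l t s • S.C l s' t' ∈ S.strictUpper l :=
  Classical.choose_spec (S.exists_gram l) s' t s t'

/-- The bracket `C_R^l × _LC^l → R`, an `R`-bilinear map on the underlying free modules of the right
and left cell modules (with bases `Rt l` and `L l`). -/
noncomputable def bracket {R A : Type*} [CommRing R] [Ring A] [Algebra R A]
    (S : CellStructure R A) (l : S.Λ) : (S.Rt l →₀ R) →ₗ[R] (S.L l →₀ R) →ₗ[R] R :=
  Finsupp.linearCombination R (fun t => Finsupp.linearCombination R (fun s => S.gram l t s))

/-- `Λ₀`, the set of the `l` at which the bracket is not identically zero. -/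
def Λ₀ {R A : Type*} [CommRing R] [Ring A] [Algebra R A] (S : CellStructure R A) : Set S.Λ :=
  {l | ∃ (x : S.Rt l →₀ R) (y : S.L l →₀ R), S.bracket l x y ≠ 0}

end CellStructure

/-! ## Twisted monoid algebras -/

/-- A twisting on the monoid `M` with values in `R`. -/
structure Twisting (R M : Type*) [CommRing R] [Monoid M] where
  toFun : M → M → R
  cocycle : ∀ x y z : M, toFun x y * toFun (x * y) z = toFun x (y * z) * toFun y z
  map_one_right : ∀ x : M, toFun x 1 = 1
  map_one_left : ∀ x : M, toFun 1 x = 1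

/-- Strong compatibility of a twisting with Green's relations. -/
def Twisting.StronglyCompatible {R M : Type*} [CommRing R] [Monoid M] (π : Twisting R M) : Prop :=
  (∀ a x : M, GreenD (a * x) x → ∀ y ∈ HClass x,
    π.toFun a y = π.toFun a x ∧ π.toFun a x ≠ 0) ∧
  (∀ a x : M, GreenD (x * a) x → ∀ y ∈ HClass x,
    π.toFun y a = π.toFun x a ∧ π.toFun x a ≠ 0)

/-- The twisted monoid algebra `R^π[M]`: the free `R`-module on `M`, with the multiplication
`x ∘ y = π(x, y) xy` on basis elements. -/
def TwistedMonoidAlgebra {R M : Type*} [CommRing R] [Monoid M] (_π : Twisting R M) : Type _ :=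
  M →₀ R

namespace TwistedMonoidAlgebra

noncomputable instance instAddCommGroup {R M : Type*} [CommRing R] [Monoid M]
    (π : Twisting R M) : AddCommGroup (TwistedMonoidAlgebra π) := inferInstanceAs (AddCommGroup (M →₀ R))

noncomputable instance {R M : Type*} [CommRing R] [Monoid M] (π : Twisting R M) :
    Module R (TwistedMonoidAlgebra π) := inferInstanceAs (Module R (M →₀ R))

/-- The basis element `m` of `R^π[M]`, multiplied by the scalar `a`. -/
noncomputable def single {R M : Type*} [CommRing R] [Monoid M] (π : Twisting R M) (m : M) (a : R) :
    TwistedMonoidAlgebra π := (Finsupp.single m a : M →₀ R)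

/-- The multiplication as a bilinear map. -/
noncomputable def mulBilin {R M : Type*} [CommRing R] [Monoid M] (π : Twisting R M) :
    TwistedMonoidAlgebra π →ₗ[R] TwistedMonoidAlgebra π →ₗ[R] TwistedMonoidAlgebra π :=
  Finsupp.linearCombination R (fun x : M =>
    (Finsupp.linearCombination R (fun y : M => single π (x * y) (π.toFun x y)) :
      (M →₀ R) →ₗ[R] TwistedMonoidAlgebra π))

theorem mulBilin_single {R M : Type*} [CommRing R] [Monoid M] (π : Twisting R M) (x y : M)
    (a b : R) :
    mulBilin π (single π x a) (single π y b) = single π (x * y) (a * b * π.toFun x y) := by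
  have h : mulBilin π (single π x a) (single π y b) =
      a • b • single π (x * y) (π.toFun x y) := by
    have e1 : mulBilin π (single π x a) =
        a • (Finsupp.linearCombination R (fun y : M => single π (x * y) (π.toFun x y)) :
          (M →₀ R) →ₗ[R] TwistedMonoidAlgebra π) :=
      Finsupp.linearCombination_single R a x
    have e2 : (Finsupp.linearCombination R (fun y : M => single π (x * y) (π.toFun x y)) :
        (M →₀ R) →ₗ[R] TwistedMonoidAlgebra π) (single π y b) =
          b • single π (x * y) (π.toFun x y) :=
      Finsupp.linearCombination_single R b y
    rw [e1, ← e2]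
    rfl
  rw [h]
  unfold single
  change a • b • (Finsupp.single (x * y) (π.toFun x y) : M →₀ R) = _
  rw [Finsupp.smul_single, Finsupp.smul_single, smul_eq_mul, smul_eq_mul, mul_assoc]

/-- Induction on the elements of `R^π[M]`. -/
theorem induction_on {R M : Type*} [CommRing R] [Monoid M] {π : Twisting R M}
    {P : TwistedMonoidAlgebra π → Prop} (f : TwistedMonoidAlgebra π) (zero : P 0)
    (add : ∀ f g, P f → P g → P (f + g)) (base : ∀ m a, P (single π m a)) : P f :=
  Finsupp.induction_linear (motive := P) f zero add base

noncomputable instance {R M : Type*} [CommRing R] [Monoid M] (π : Twisting R M) :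
    Ring (TwistedMonoidAlgebra π) :=
  { instAddCommGroup π with
    mul := fun f g => mulBilin π f g
    one := single π 1 1
    left_distrib := fun f g h => map_add (mulBilin π f) g h
    right_distrib := fun f g h => by
      change mulBilin π (f + g) h = mulBilin π f h + mulBilin π g h
      rw [map_add, LinearMap.add_apply]
    zero_mul := fun f => by
      change mulBilin π 0 f = 0
      rw [map_zero, LinearMap.zero_apply]
    mul_zero := fun f => map_zero (mulBilin π f)
    mul_assoc := fun f g h => by
      change mulBilin π (mulBilin π f g) h = mulBilin π f (mulBilin π g h)
      induction f using induction_on with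
      | zero => simp
      | add f₁ f₂ h₁ h₂ => simp [h₁, h₂]
      | base x a =>
        induction g using induction_on with
        | zero => simp
        | add g₁ g₂ h₁ h₂ => simp [h₁, h₂]
        | base y b =>
          induction h using induction_on with
          | zero => simp
          | add g₁ g₂ h₁ h₂ => simp [h₁, h₂]
          | base z c =>
            rw [mulBilin_single, mulBilin_single, mulBilin_single, mulBilin_single, mul_assoc x]
            congr 1
            linear_combination a * b * c * π.cocycle x y z
    one_mul := fun f => by
      change mulBilin π (single π 1 1) f = f
      induction f using induction_on with
      | zero => simp
      | add f₁ f₂ h₁ h₂ => simp [h₁, h₂]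
      | base x a => simp [mulBilin_single, π.map_one_left]
    mul_one := fun f => by
      change mulBilin π f (single π 1 1) = f
      induction f using induction_on with
      | zero => simp
      | add f₁ f₂ h₁ h₂ => simp [h₁, h₂]
      | base x a => simp [mulBilin_single, π.map_one_right] }

theorem single_mul_single {R M : Type*} [CommRing R] [Monoid M] (π : Twisting R M) (x y : M)
    (a b : R) : single π x a * single π y b = single π (x * y) (a * b * π.toFun x y) :=
  mulBilin_single π x y a b

noncomputable instance {R M : Type*} [CommRing R] [Monoid M] (π : Twisting R M) :
    Algebra R (TwistedMonoidAlgebra π) :=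
  Algebra.ofModule
    (fun r f g => by
      change mulBilin π (r • f) g = r • mulBilin π f g
      rw [map_smul, LinearMap.smul_apply])
    (fun r f g => map_smul (mulBilin π f) r g)

end TwistedMonoidAlgebra

/-! ## Quasi-hereditary algebras -/

/-- A two-sided ideal `J` of a ring `B` is a heredity ideal if `J² = J`, `J · rad(B) · J = 0`, and
`J` is projective as a left `B`-module. -/
def IsHeredityIdeal {B : Type*} [Ring B] (J : Ideal B) : Prop :=
  J.IsTwoSided ∧ J * J = J ∧
    (∀ x ∈ J, ∀ r ∈ Ring.jacobson B, ∀ y ∈ J, x * r * y = 0) ∧ Module.Projective B J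

/-- A finite-dimensional algebra over a field `k` is quasi-hereditary if it has a chain of two-sided
ideals `0 = J₀ ⊂ J₁ ⊂ ⋯ ⊂ J_n = A` (a heredity chain) such that `J_{i+1} / J_i` is a heredity
ideal of `A / J_i` for every `i`. -/
def IsQuasiHereditary (k A : Type*) [Field k] [Ring A] [Algebra k A] : Prop :=
  Module.Finite k A ∧
    ∃ (n : ℕ) (J : Fin (n + 1) → Ideal A) (_ : ∀ i, (J i).IsTwoSided),
      StrictMono J ∧ J 0 = ⊥ ∧ J (Fin.last n) = ⊤ ∧
        ∀ i : Fin n, IsHeredityIdeal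
          ((J i.succ).map (Ideal.Quotient.mk (J i.castSucc)))

/-! The elements of a `𝓓`-class `D` have coordinates: writing `γ` for its base element, each is `u *
h * v`, where `u` moves `γ` to a given `𝓡`-class, `v` moves it to a given `𝓛`-class, and `h` lies in
the `𝓗`-class of `γ`, on which the Schützenberger group acts simply transitively. Multiplying by a
monoid element either leaves `D` for a class strictly lower in the `𝓙`-order, or permits Green's
lemma: a left factor changes the row and translates the group coordinate on the left, a right factor
does the same for columns. Strong compatibility makes the twisting scalars nonzero and constant
along the group coordinate, so modulo lower classes the layer of `D` consists of matrices over the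
untwisted group algebra `k[G_D]`. Thus the twisted algebra is an `IteratedInflation` of the group
algebras.

Placing a cell basis of `k[G_D]` in every matrix position gives a cell basis of the whole algebra,
with the cell posets summed lexicographically (`IteratedInflation.cellStructure`). Regularity
supplies, for each `D`, a column and a row whose product stays in `D`. Multiplication through that
position inserts a nonzero multiple of a group element, a unit of `k[G_D]`, and inserting a unit
cannot kill a nonzero bracket (`exists_coord_mul_unit_mul_ne_zero`). So all brackets of the big cell
algebra are nonzero.

Finally, a cell algebra with nonzero brackets is quasi-hereditary. Adding the cells one at a time
from the top gives a chain of ideals. In a layer with basis `c s t`, a nonzero bracket `φ` at `(t₀,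
s₀)` makes `φ⁻¹ • c s₀ t₀` an idempotent through which every `c s t` factors, and the three heredity
conditions follow (`isHeredityIdeal_of_cell_basis`). -/

/-! ### Heredity ideals from matrix-like bases -/

/-- An idempotent in the Jacobson radical vanishes. -/
theorem eq_zero_of_isIdempotentElem_of_mem_jacobson {B : Type*} [Ring B] {e : B}
    (he : e * e = e) (h : e ∈ Ring.jacobson B) : e = 0 := by
  rw [← Ideal.jacobson_bot, Ideal.mem_jacobson_iff] at h
  -- The multiplier `-1` makes `z` a left inverse of `1 - e`, which annihilates `e`.
  obtain ⟨z, hz⟩ := h (-1)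
  rw [Ideal.mem_bot, sub_eq_zero] at hz
  calc e = (z * -1 * e + z) * e := by rw [hz, one_mul]
    _ = -(z * (e * e)) + z * e := by noncomm_ring
    _ = 0 := by rw [he]; simp

/-- An ideal with a matrix-like basis on which the algebra acts row- and columnwise, and whose
multiplication is not identically zero, is a heredity ideal. -/
theorem isHeredityIdeal_of_cell_basis {k B ι κ : Type*} [Field k] [Ring B] [Algebra k B]
    [Fintype ι] [Fintype κ] (J : Ideal B) (c : ι → κ → B)
    (hc : LinearIndependent k (fun p : ι × κ => c p.1 p.2))
    (hJ : J.restrictScalars k = Submodule.span k (Set.range fun p : ι × κ => c p.1 p.2))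
    (hl : ∀ b : B, ∃ r : ι → ι → k, ∀ s t, b * c s t = ∑ s', r s s' • c s' t)
    (hr : ∀ b : B, ∃ r : κ → κ → k, ∀ s t, c s t * b = ∑ t', r t t' • c s t')
    (s₀ : ι) (t₀ : κ) (φ : k) (hφ : φ ≠ 0)
    (h₀ : ∀ s t, c s t₀ * c s₀ t = φ • c s t) : IsHeredityIdeal J := by
  classical
  have hcJ : ∀ s t, c s t ∈ J := fun s t => by
    have : c s t ∈ J.restrictScalars k := by
      rw [hJ]; exact Submodule.subset_span ⟨(s, t), rfl⟩
    exact this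
  have ind : ∀ {P : B → Prop}, P 0 → (∀ x y, P x → P y → P (x + y)) →
      (∀ (a : k) x, P x → P (a • x)) → (∀ s t, P (c s t)) → ∀ x ∈ J, P x := by
    intro P h0 hadd hsmul hbase x hx
    have hx' : x ∈ Submodule.span k (Set.range fun p : ι × κ => c p.1 p.2) := by
      rw [← hJ]; exact hx
    clear hx
    induction hx' using Submodule.span_induction with
    | mem x h => obtain ⟨p, rfl⟩ := h; exact hbase _ _
    | zero => exact h0
    | add x y _ _ h1 h2 => exact hadd x y h1 h2
    | smul a x _ h1 => exact hsmul a x h1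
  have hsm : ∀ (a : k) {x : B}, x ∈ J → a • x ∈ J := fun a x hx =>
    (J.restrictScalars k).smul_mem a hx
  -- This factorization inside `J` yields `J * J = J`; at `(s₀, t₀)` it says that `φ⁻¹ • c s₀ t₀` is
  -- idempotent.
  have hfac : ∀ s t, c s t = c s t₀ * (φ⁻¹ • c s₀ t) := fun s t => by
    rw [mul_smul_comm, h₀, smul_smul, inv_mul_cancel₀ hφ, one_smul]
  have htwo : J.IsTwoSided := ⟨fun {x} b hx => by
    refine ind (P := fun x => x * b ∈ J) ?_ ?_ ?_ ?_ x hx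
    · simp
    · intro x y h1 h2
      rw [add_mul]; exact J.add_mem h1 h2
    · intro a x h
      rw [smul_mul_assoc]; exact hsm a h
    · intro s t
      obtain ⟨r, hr'⟩ := hr b
      rw [hr']
      exact J.sum_mem fun t' _ => hsm _ (hcJ _ _)⟩
  refine ⟨htwo, ?_, ?_, ?_⟩
  · refine le_antisymm Ideal.mul_le_left fun x hx => ?_
    refine ind (P := fun x => x ∈ J * J) (zero_mem _) (fun x y => add_mem) ?_ ?_ x hx
    · intro a x h
      rw [Algebra.smul_def]
      exact Ideal.mul_mem_left _ _ h
    · intro s t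
      rw [hfac]
      exact Ideal.mul_mem_mul (hcJ _ _) (hsm _ (hcJ _ _))
  -- By `hl` this product lies in column `t₀`, by `hr` in row `s₀`, so it is a multiple of `c s₀
  -- t₀`. A nonzero multiple would put the idempotent `φ⁻¹ • c s₀ t₀` in the radical. After applying
  -- `hfac` to both outer factors, every `c s t * r * c s' t'` contains such a product.
  · have hmid : ∀ r ∈ Ring.jacobson B, ∀ s t, c s₀ t * r * c s t₀ = 0 := by
      intro r hr' s t
      obtain ⟨x, hx⟩ := hl (c s₀ t * r)
      obtain ⟨y, hy⟩ := hr (r * c s t₀)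
      have e1 := hx s t₀
      have e2 := hy s₀ t
      rw [← mul_assoc] at e2
      have e3 : ∀ s', s' ≠ s₀ → x s s' = 0 := by
        intro s' hs'
        have e4 : (∑ p : ι × κ, ((if p.2 = t₀ then x s p.1 else 0) -
            (if p.1 = s₀ then y t p.2 else 0)) • c p.1 p.2) = 0 := by
          simp only [sub_smul, Finset.sum_sub_distrib, Fintype.sum_prod_type, ite_smul, zero_smul,
            Finset.sum_ite_eq', Finset.mem_univ, if_true]
          rw [Finset.sum_comm (s := Finset.univ) (t := Finset.univ) (f := fun a b =>
            if a = s₀ then y t b • c a b else 0)]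
          simp only [Finset.sum_ite_eq', Finset.mem_univ, if_true]
          rw [← e1, ← e2, sub_self]
        have := Fintype.linearIndependent_iff.1 hc _ e4 (s', t₀)
        simpa [hs'] using this
      rw [Finset.sum_eq_single s₀ (fun s' _ h => by rw [e3 s' h, zero_smul]) (by simp)] at e1
      rw [e1]
      by_cases hx0 : x s s₀ = 0
      · rw [hx0, zero_smul]
      · exfalso
        have hmem : c s₀ t * r * c s t₀ ∈ Ring.jacobson B :=
          Ideal.mul_mem_right _ _ (Ideal.mul_mem_left _ _ hr')
        rw [e1] at hmem
        have hmem' : φ⁻¹ • c s₀ t₀ ∈ Ring.jacobson B := by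
          have := ((Ring.jacobson B).restrictScalars k).smul_mem (φ⁻¹ * (x s s₀)⁻¹) hmem
          rw [smul_smul, mul_assoc, inv_mul_cancel₀ hx0, mul_one] at this
          exact this
        have hz := eq_zero_of_isIdempotentElem_of_mem_jacobson (by
          rw [smul_mul_assoc, ← hfac]) hmem'
        refine hc.ne_zero (s₀, t₀) ?_
        rw [smul_eq_zero] at hz
        exact hz.resolve_left (inv_ne_zero hφ)
    intro x hx r hr' y hy
    revert y
    refine ind (P := fun x => ∀ y ∈ J, x * r * y = 0) ?_ ?_ ?_ ?_ x hx
    · intro y _; simp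
    · intro x x' h1 h2 y hy
      rw [add_mul, add_mul, h1 y hy, h2 y hy, add_zero]
    · intro a x h y hy
      rw [smul_mul_assoc, smul_mul_assoc, h y hy, smul_zero]
    · intro s t y hy
      refine ind (P := fun y => c s t * r * y = 0) ?_ ?_ ?_ ?_ y hy
      · simp
      · intro y y' h1 h2
        rw [mul_add, h1, h2, add_zero]
      · intro a y h
        rw [mul_smul_comm, h, smul_zero]
      · intro s' t'
        rw [hfac s t, hfac s' t']
        have := hmid r hr' s' t
        simp only [smul_mul_assoc, mul_smul_comm]
        rw [show c s t₀ * c s₀ t * r * (c s' t₀ * c s₀ t') =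
          c s t₀ * (c s₀ t * r * c s' t₀) * c s₀ t' by noncomm_ring, this]
        simp
  -- `F t` moves column `t` to column `t₀` and kills the others. The extension from `J` to `B` is
  -- arbitrary and only `k`-linear; on `J` it commutes with left multiplication because `B` acts on
  -- all columns by the same coefficients.
  · have hF : ∀ t, ∃ F : B →ₗ[k] B, ∀ s t', F (c s t') = if t' = t then c s t₀ else 0 := by
      intro t
      obtain ⟨F, hF⟩ := LinearMap.exists_extend ((Module.Basis.span hc).constr k
        (fun p : ι × κ => if p.2 = t then c p.1 t₀ else 0))
      refine ⟨F, fun s t' => ?_⟩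
      have := (Module.Basis.span hc).constr_basis k
        (fun p : ι × κ => if p.2 = t then c p.1 t₀ else 0) (s, t')
      rw [← hF] at this
      simpa [Module.Basis.span_apply] using this
    choose F hF using hF
    have hFmul : ∀ t (b : B), ∀ x ∈ J, F t (b * x) = b * F t x := by
      intro t b
      refine ind ?_ ?_ ?_ ?_
      · simp
      · intro x y h1 h2
        rw [mul_add, map_add, h1, h2, map_add, mul_add]
      · intro a x h
        rw [mul_smul_comm, map_smul, h, map_smul, mul_smul_comm]
      · intro s t'
        obtain ⟨r, hr'⟩ := hl b
        rw [hr', map_sum, hF]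
        simp only [map_smul, hF]
        split_ifs with h
        · rw [hr']
        · simp
    -- `J` is a direct summand of the free module `κ → B`: `i` records the columns, and `p` restores
    -- them by multiplying with row `s₀`.
    let i : J →ₗ[B] (κ → B) :=
      { toFun := fun x t => F t x
        map_add' := fun x y => by ext t; simp
        map_smul' := fun b x => by ext t; exact hFmul t b x x.2 }
    let p : (κ → B) →ₗ[B] J :=
      { toFun := fun y => ⟨∑ t, y t * (φ⁻¹ • c s₀ t),
          J.sum_mem fun t _ => J.mul_mem_left _ (hsm _ (hcJ _ _))⟩
        map_add' := fun x y => by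
          ext; simp [add_mul, Finset.sum_add_distrib]
        map_smul' := fun b x => by
          ext; simp [Finset.mul_sum, mul_assoc] }
    refine Module.Projective.of_split i p (LinearMap.ext fun x => Subtype.ext ?_)
    change ∑ t, F t x * (φ⁻¹ • c s₀ t) = x
    refine ind (P := fun x => ∑ t, F t x * (φ⁻¹ • c s₀ t) = x) ?_ ?_ ?_ ?_ x x.2
    · simp
    · intro x y h1 h2
      simp only [map_add, add_mul, Finset.sum_add_distrib, h1, h2]
    · intro a x h
      simp only [map_smul, smul_mul_assoc, ← Finset.smul_sum, h]
    · intro s t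
      simp only [hF, ite_mul, zero_mul, Finset.sum_ite_eq, Finset.mem_univ, if_true]
      exact (hfac s t).symm

/-! ### Cell algebras with nonzero brackets are quasi-hereditary -/

namespace CellStructure

variable {k A : Type*} [Field k] [Ring A] [Algebra k A] (S : CellStructure k A)

theorem exists_gram_ne_zero {l : S.Λ} (hl : l ∈ S.Λ₀) : ∃ t s, S.gram l t s ≠ 0 := by
  obtain ⟨x, y, hxy⟩ := hl
  by_contra! h
  apply hxy
  have : S.gram l = 0 := by
    ext t s
    exact h t s
  simp [bracket, this, Finsupp.linearCombination_apply]

/-- The span of the cell basis elements indexed by an upper set. -/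
def upperSpan (U : Set S.Λ) : Submodule k A :=
  Submodule.span k {x : A | ∃ l ∈ U, ∃ s t, x = S.C l s t}

variable {S} in
theorem C_mem_upperSpan {U : Set S.Λ} {l : S.Λ} (hl : l ∈ U) (s : S.L l) (t : S.Rt l) :
    S.C l s t ∈ S.upperSpan U :=
  Submodule.subset_span ⟨l, hl, s, t, rfl⟩

variable {S} in
theorem upperSpan_mono {U V : Set S.Λ} (h : U ⊆ V) : S.upperSpan U ≤ S.upperSpan V :=
  Submodule.span_mono fun _ ⟨l, hl, s, t, hx⟩ => ⟨l, h hl, s, t, hx⟩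

variable {S} in
theorem strictUpper_le_upperSpan {U : Set S.Λ} {l : S.Λ} (h : ∀ μ, l < μ → μ ∈ U) :
    S.strictUpper l ≤ S.upperSpan U :=
  Submodule.span_mono fun _ ⟨μ, hμ, s, t, hx⟩ => ⟨μ, h μ hμ, s, t, hx⟩

theorem coord_upperSpan {U : Set S.Λ} {l : S.Λ} (hl : l ∉ U) (s : S.L l) (t : S.Rt l) {x : A}
    (hx : x ∈ S.upperSpan U) : S.basis.coord ⟨l, s, t⟩ x = 0 := by
  classical
  have h : S.upperSpan U ≤ LinearMap.ker (S.basis.coord ⟨l, s, t⟩) := by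
    rw [upperSpan, Submodule.span_le]
    rintro _ ⟨μ, hμ, s', t', rfl⟩
    have hne : (⟨μ, s', t'⟩ : Σ l : S.Λ, S.L l × S.Rt l) ≠ ⟨l, s, t⟩ := by
      intro e
      obtain rfl : μ = l := congrArg Sigma.fst e
      exact hl hμ
    simp [C, hne]
  exact h hx

theorem mul_mem_upperSpan {U : Set S.Λ} (hU : IsUpperSet U) (a : A) {x : A}
    (hx : x ∈ S.upperSpan U) : a * x ∈ S.upperSpan U := by
  induction hx using Submodule.span_induction with
  | mem x h =>
    obtain ⟨l, hl, s, t, rfl⟩ := h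
    obtain ⟨r, hr⟩ := S.left_cell a l
    have h2 := strictUpper_le_upperSpan (fun μ hμ => hU hμ.le hl) (hr s t)
    exact (Submodule.sub_mem_iff_left _
      (Submodule.sum_mem _ fun s' _ => Submodule.smul_mem _ _ (C_mem_upperSpan hl _ _))).1 h2
  | zero => simp
  | add x y _ _ h1 h2 => rw [mul_add]; exact add_mem h1 h2
  | smul c x _ h => rw [mul_smul_comm]; exact Submodule.smul_mem _ _ h

theorem mem_upperSpan_mul {U : Set S.Λ} (hU : IsUpperSet U) (a : A) {x : A}
    (hx : x ∈ S.upperSpan U) : x * a ∈ S.upperSpan U := by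
  induction hx using Submodule.span_induction with
  | mem x h =>
    obtain ⟨l, hl, s, t, rfl⟩ := h
    obtain ⟨r, hr⟩ := S.right_cell a l
    have h2 := strictUpper_le_upperSpan (fun μ hμ => hU hμ.le hl) (hr s t)
    exact (Submodule.sub_mem_iff_left _
      (Submodule.sum_mem _ fun s' _ => Submodule.smul_mem _ _ (C_mem_upperSpan hl _ _))).1 h2
  | zero => simp
  | add x y _ _ h1 h2 => rw [add_mul]; exact add_mem h1 h2
  | smul c x _ h => rw [smul_mul_assoc]; exact Submodule.smul_mem _ _ h

/-- The two-sided ideal spanned by the cell basis elements indexed by an upper set. -/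
def upperIdeal (U : UpperSet S.Λ) : Ideal A where
  __ := S.upperSpan (U : Set S.Λ)
  smul_mem' a _ hx := S.mul_mem_upperSpan U.upper a hx

variable {S} in
theorem mem_upperIdeal {U : UpperSet S.Λ} {x : A} :
    x ∈ S.upperIdeal U ↔ x ∈ S.upperSpan (U : Set S.Λ) := Iff.rfl

instance (U : UpperSet S.Λ) : (S.upperIdeal U).IsTwoSided :=
  ⟨fun a hx => S.mem_upperSpan_mul U.upper a hx⟩

theorem upperSpan_univ : S.upperSpan Set.univ = ⊤ := by
  rw [eq_top_iff, ← S.basis.span_eq]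
  refine Submodule.span_mono ?_
  rintro _ ⟨⟨l, s, t⟩, rfl⟩
  exact ⟨l, trivial, s, t, rfl⟩

/-- The layers of the filtration of a cell algebra by ideals are heredity ideals, when the brackets
do not vanish. -/
theorem isHeredityIdeal_map_upperIdeal (U V : UpperSet S.Λ) (l : S.Λ) (hl : l ∈ S.Λ₀)
    (hlU : l ∉ U) (hV : ∀ μ, μ ∈ V ↔ μ ∈ U ∨ μ = l) (hupper : ∀ μ, l < μ → μ ∈ U) :
    IsHeredityIdeal ((S.upperIdeal V).map (Ideal.Quotient.mk (S.upperIdeal U))) := by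
  classical
  obtain ⟨t₀, s₀, h₀⟩ := S.exists_gram_ne_zero hl
  have hstrict : ∀ {x}, x ∈ S.strictUpper l → x ∈ S.upperIdeal U :=
    fun hx => strictUpper_le_upperSpan hupper hx
  let q : A →ₐ[k] A ⧸ S.upperIdeal U := Ideal.Quotient.mkₐ k (S.upperIdeal U)
  have hq : ∀ x, q x = Ideal.Quotient.mk (S.upperIdeal U) x := fun _ => rfl
  have hqz : ∀ {x y}, x - y ∈ S.strictUpper l → q x = q y := fun hx =>
    Ideal.Quotient.eq.2 (hstrict hx)
  have hqs : Function.Surjective q := Ideal.Quotient.mk_surjective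
  refine isHeredityIdeal_of_cell_basis (k := k) _ (fun s t => q (S.C l s t)) ?_ ?_ ?_ ?_ s₀ t₀
    (S.gram l t₀ s₀) h₀ ?_
  · rw [Fintype.linearIndependent_iff]
    rintro g hg ⟨s, t⟩
    simp only [← map_smul, ← map_sum] at hg
    rw [hq, Ideal.Quotient.eq_zero_iff_mem] at hg
    have := S.coord_upperSpan (U := U) hlU s t hg
    rw [map_sum, Finset.sum_eq_single (s, t)] at this
    · simpa [C] using this
    · rintro ⟨s', t'⟩ _ hne
      have hne' : (⟨l, s', t'⟩ : Σ l : S.Λ, S.L l × S.Rt l) ≠ ⟨l, s, t⟩ := by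
        intro e
        simp only [Sigma.mk.injEq, heq_eq_eq, true_and] at e
        exact hne e
      simp [C, hne']
    · simp
  · apply le_antisymm
    · intro x hx
      obtain ⟨y, hy, rfl⟩ := (Ideal.mem_map_iff_of_surjective _ Ideal.Quotient.mk_surjective).1 hx
      have hy' : y ∈ S.upperSpan (V : Set S.Λ) := hy
      have hle : S.upperSpan (V : Set S.Λ) ≤ Submodule.comap q.toLinearMap (Submodule.span k
          (Set.range fun p : S.L l × S.Rt l => q (S.C l p.1 p.2))) := by
        rw [upperSpan, Submodule.span_le]
        rintro _ ⟨μ, hμ, s, t, rfl⟩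
        rw [SetLike.mem_coe, Submodule.mem_comap]
        change q (S.C μ s t) ∈ (Submodule.span k _ : Submodule k (A ⧸ S.upperIdeal U))
        rcases (hV μ).1 hμ with h | rfl
        · have : q (S.C μ s t) = 0 := Ideal.Quotient.eq_zero_iff_mem.2 (C_mem_upperSpan h s t)
          rw [this]
          exact Submodule.zero_mem _
        · exact Submodule.subset_span ⟨(s, t), rfl⟩
      exact hle hy'
    · rw [Submodule.span_le]
      rintro _ ⟨p, rfl⟩
      exact Ideal.mem_map_of_mem _ (C_mem_upperSpan (U := (V : Set S.Λ)) ((hV l).2 (Or.inr rfl)) _ _)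
  · intro b
    obtain ⟨a, rfl⟩ := hqs b
    obtain ⟨r, hr⟩ := S.left_cell a l
    refine ⟨r, fun s t => ?_⟩
    have := hqz (hr s t)
    simpa [C, map_sum] using this
  · intro b
    obtain ⟨a, rfl⟩ := hqs b
    obtain ⟨r, hr⟩ := S.right_cell a l
    refine ⟨r, fun s t => ?_⟩
    have := hqz (hr s t)
    simpa [C, map_sum] using this
  · intro s t
    have := hqz (S.gram_spec l s t₀ s₀ t)
    simpa using this

/-- A finite partial order has an order-reversing enumeration. -/
theorem _root_.exists_antitone_enumeration (α : Type*) [PartialOrder α] [Finite α] :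
    ∃ (n : ℕ) (σ : α → Fin n), Function.Bijective σ ∧ StrictAnti σ := by
  have : Fintype (LinearExtension α) := Fintype.ofFinite α
  let e := (monoEquivOfFin (LinearExtension α) rfl).symm
  refine ⟨_, fun l => (e (toLinearExtension l)).rev,
    (Fin.rev_bijective.comp e.bijective).comp Function.bijective_id, fun l μ h => ?_⟩
  exact Fin.rev_lt_rev.2 (e.strictMono (lt_of_le_of_ne (toLinearExtension.monotone h.le) h.ne))

/-- A cell algebra all of whose brackets are nonzero is quasi-hereditary. -/
theorem isQuasiHereditary (h : S.Λ₀ = Set.univ) : IsQuasiHereditary k A := by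
  have hmem : ∀ l, l ∈ S.Λ₀ := fun l => h ▸ Set.mem_univ l
  obtain ⟨n, σ, ⟨hσi, hσs⟩, hσ⟩ := exists_antitone_enumeration S.Λ
  -- Since `σ` reverses the order, its initial segments are upper sets, and each step adds exactly
  -- one cell.
  obtain ⟨U, hU⟩ : ∃ U : Fin (n + 1) → UpperSet S.Λ, ∀ i l, l ∈ U i ↔ (σ l : ℕ) < i :=
    ⟨fun i => ⟨{l | (σ l : ℕ) < i}, fun l μ hlμ (hl : (σ l : ℕ) < i) =>
      lt_of_le_of_lt (Fin.le_def.1 (hσ.antitone hlμ)) hl⟩,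
      fun _ _ => Iff.rfl⟩
  refine ⟨Module.Finite.of_basis S.basis, n, fun i => S.upperIdeal (U i),
    fun i => inferInstance, ?_, ?_, ?_, ?_⟩
  · rw [Fin.strictMono_iff_lt_succ]
    intro i
    obtain ⟨l, rfl⟩ := hσs i
    refine lt_of_le_of_ne (fun x hx => ?_) fun heq => ?_
    · refine upperSpan_mono (fun μ hμ => ?_) hx
      have := (hU _ _).1 hμ
      refine (hU _ _).2 (lt_trans this ?_)
      simp
    -- Strictness needs a basis element in the cell `l`; the nonzero bracket guarantees that both
    -- index sets are inhabited.
    · obtain ⟨t, s, -⟩ := S.exists_gram_ne_zero (hmem l)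
      have h1 : S.C l s t ∈ S.upperIdeal (U (σ l).succ) :=
        C_mem_upperSpan (U := (U (σ l).succ : Set S.Λ)) ((hU _ _).2 (by simp)) s t
      rw [← heq] at h1
      have := S.coord_upperSpan (U := U (σ l).castSucc) (fun h => by
        have := (hU _ _).1 h
        simp at this) s t h1
      simp [C] at this
  · rw [eq_bot_iff]
    intro x hx
    have hx' : x ∈ S.upperSpan (U 0 : Set S.Λ) := hx
    have h0 : (U 0 : Set S.Λ) = ∅ := by
      ext l
      rw [SetLike.mem_coe, hU]
      simp
    rw [h0, upperSpan] at hx'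
    simpa using hx'
  · rw [eq_top_iff]
    intro x _
    have h1 : (U (Fin.last n) : Set S.Λ) = Set.univ := by
      ext l
      rw [SetLike.mem_coe, hU]
      simp
    rw [mem_upperIdeal, h1, upperSpan_univ]
    trivial
  · intro i
    obtain ⟨l, rfl⟩ := hσs i
    refine S.isHeredityIdeal_map_upperIdeal _ _ l (hmem l) ?_ ?_ ?_
    · rw [hU]; simp
    · intro μ
      rw [hU, hU, ← hσi.eq_iff, Fin.ext_iff]
      simp only [Fin.val_succ, Fin.val_castSucc]
      omega
    · intro μ hμ
      rw [hU]
      exact hσ hμ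

end CellStructure

-- Iterated inflations of cell algebras

universe v₁ v₂

namespace CellStructure

variable {k A : Type*} [Field k] [Ring A] [Algebra k A] (S : CellStructure k A)

theorem mem_Λ₀_of_gram_ne_zero {l : S.Λ} {t : S.Rt l} {s : S.L l} (h : S.gram l t s ≠ 0) :
    l ∈ S.Λ₀ :=
  ⟨Finsupp.single t 1, Finsupp.single s 1, by simpa [bracket] using h⟩

theorem mul_mem_strictUpper {l : S.Λ} (a : A) {x : A} (hx : x ∈ S.strictUpper l) :
    a * x ∈ S.strictUpper l :=
  S.mul_mem_upperSpan (U := Set.Ioi l) (isUpperSet_Ioi l) a hx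

/-- If the bracket at `l` does not vanish, multiplication through a unit does not vanish on the
layer at `l` either. -/
theorem exists_coord_mul_unit_mul_ne_zero {l : S.Λ} (hl : l ∈ S.Λ₀) {p : A} (hp : IsUnit p) :
    ∃ s' t s t', S.basis.coord ⟨l, s', t'⟩ (S.C l s' t * p * S.C l s t') ≠ 0 := by
  classical
  obtain ⟨t, s₁, hg⟩ := S.exists_gram_ne_zero hl
  obtain ⟨q, hpq⟩ := hp.exists_right_inv
  by_contra! h
  -- The square of `C l s₁ t` equals `(C l s₁ t * p) * (q * C l s₁ t)`. Expanding the second factor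
  -- along rows, the assumption `h` forces the coordinate of the square at `(s₁, t)` to vanish; but
  -- that coordinate is `gram l t s₁`.
  obtain ⟨r, hr⟩ := S.left_cell q l
  have h1 := S.mul_mem_strictUpper (S.C l s₁ t * p) (hr s₁ t)
  have h2 := S.coord_strictUpper l s₁ t h1
  rw [mul_sub, map_sub, ← mul_assoc, mul_assoc _ p q, hpq, mul_one, Finset.mul_sum, map_sum,
    Finset.sum_eq_zero, sub_zero] at h2
  · have h3 := S.coord_strictUpper l s₁ t (S.gram_spec l s₁ t s₁ t)
    rw [map_sub, sub_eq_zero] at h3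
    change S.basis.coord _ (S.C l s₁ t * S.C l s₁ t) = 0 at h2
    rw [h2] at h3
    simp [C] at h3
    exact hg h3.symm
  · intro s' _
    rw [mul_smul_comm, map_smul]
    change r s₁ s' • S.basis.coord _ (S.C l s₁ t * p * S.C l s' t) = 0
    rw [h s₁ t s' t, smul_zero]

end CellStructure

open Classical in
/-- An algebra glued, along a finite poset `Δ`, from spaces of `I d × J d`-matrices over algebras
`B d`: modulo higher layers, left multiplication acts on rows and right multiplication acts on
columns. -/
structure IteratedInflation (k A : Type*) [Field k] [Ring A] [Algebra k A] (Δ : Type*)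
    [PartialOrder Δ] (I J : Δ → Type*) [∀ d, Fintype (I d)] [∀ d, Fintype (J d)] (B : Δ → Type*)
    [∀ d, Ring (B d)] [∀ d, Algebra k (B d)] where
  equiv : (∀ q : Σ d, I d × J d, B q.1) ≃ₗ[k] A
  left : ∀ (a : A) (d : Δ), ∃ θ : I d → I d → B d, ∀ i j x,
    a * equiv (Pi.single ⟨d, i, j⟩ x) - ∑ i', equiv (Pi.single ⟨d, i', j⟩ (θ i i' * x)) ∈
      Submodule.span k {y : A | ∃ d', d < d' ∧ ∃ i j x, y = equiv (Pi.single ⟨d', i, j⟩ x)}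
  right : ∀ (a : A) (d : Δ), ∃ θ : J d → J d → B d, ∀ i j x,
    equiv (Pi.single ⟨d, i, j⟩ x) * a - ∑ j', equiv (Pi.single ⟨d, i, j'⟩ (x * θ j j')) ∈
      Submodule.span k {y : A | ∃ d', d < d' ∧ ∃ i j x, y = equiv (Pi.single ⟨d', i, j⟩ x)}

namespace IteratedInflation

variable {k A : Type*} [Field k] [Ring A] [Algebra k A] {Δ : Type v₁}
  [PartialOrder Δ] {I J : Δ → Type v₁} [∀ d, Fintype (I d)] [∀ d, Fintype (J d)] {B : Δ → Type*}
  [∀ d, Ring (B d)] [∀ d, Algebra k (B d)] (P : IteratedInflation k A Δ I J B)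

open Classical in
/-- The matrices in layer `d` supported at the position `(i, j)`. -/
noncomputable def block (d : Δ) (i : I d) (j : J d) : B d →ₗ[k] A :=
  P.equiv.toLinearMap ∘ₗ LinearMap.single k (fun q : Σ d, I d × J d => B q.1) ⟨d, i, j⟩

/-- The span of the layers above `d`. -/
noncomputable def higher (d : Δ) : Submodule k A :=
  Submodule.span k {y : A | ∃ d', d < d' ∧ ∃ i j x, y = P.block d' i j x}

theorem exists_left (a : A) (d : Δ) : ∃ θ : I d → I d → B d, ∀ i j x,
    a * P.block d i j x - ∑ i', P.block d i' j (θ i i' * x) ∈ P.higher d := P.left a d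

theorem exists_right (a : A) (d : Δ) : ∃ θ : J d → J d → B d, ∀ i j x,
    P.block d i j x * a - ∑ j', P.block d i j' (x * θ j j') ∈ P.higher d := P.right a d

variable [Fintype Δ] (S : ∀ d, CellStructure.{v₂} k (B d))

/-- The index type of the cell basis, sorted by layer and cell. -/
def cellIndexEquiv : (Σ q : Σ d, I d × J d, Σ l : (S q.1).Λ, (S q.1).L l × (S q.1).Rt l) ≃
    Σ l : Σₗ d, (S d).Λ, (I l.1 × (S l.1).L l.2) × ((S l.1).Rt l.2 × J l.1) where
  toFun x := ⟨⟨x.1.1, x.2.1⟩, (x.1.2.1, x.2.2.1), (x.2.2.2, x.1.2.2)⟩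
  invFun x := ⟨⟨x.1.1, x.2.1.1, x.2.2.2⟩, x.1.2, x.2.1.2, x.2.2.1⟩
  left_inv _ := rfl
  right_inv _ := rfl

/-- The cell basis of an iterated inflation of cell algebras. -/
noncomputable def cellBasis : Module.Basis
    (Σ l : Σₗ d, (S d).Λ, (I l.1 × (S l.1).L l.2) × ((S l.1).Rt l.2 × J l.1)) k A :=
  ((Pi.basis fun q : Σ d, I d × J d => (S q.1).basis).map P.equiv).reindex (cellIndexEquiv S)

theorem cellBasis_apply (d : Δ) (l : (S d).Λ) (i : I d) (s : (S d).L l) (t : (S d).Rt l) (j : J d) :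
    P.cellBasis S ⟨⟨d, l⟩, (i, s), (t, j)⟩ = P.block d i j ((S d).C l s t) := by
  classical
  rw [cellBasis, Module.Basis.reindex_apply, Module.Basis.map_apply, Pi.basis_apply, block]
  simp only [LinearMap.comp_apply, LinearMap.coe_single]
  refine congrArg P.equiv ?_
  change (Pi.single ⟨d, i, j⟩ ((S d).C l s t) : ∀ q : Σ d, I d × J d, B q.1) = _
  congr!

theorem coord_cellBasis_block (d : Δ) (l : (S d).Λ) (i : I d) (s : (S d).L l) (t : (S d).Rt l)
    (j : J d) (x : B d) :
    (P.cellBasis S).coord ⟨⟨d, l⟩, (i, s), (t, j)⟩ (P.block d i j x) =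
      (S d).basis.coord ⟨l, s, t⟩ x := by
  classical
  have : (P.cellBasis S).coord ⟨⟨d, l⟩, (i, s), (t, j)⟩ ∘ₗ P.block d i j =
      (S d).basis.coord ⟨l, s, t⟩ := by
    refine (S d).basis.ext fun ⟨l', s', t'⟩ => ?_
    rw [LinearMap.comp_apply]
    change (P.cellBasis S).coord _ (P.block d i j ((S d).C l' s' t')) = _
    rw [← P.cellBasis_apply S d l' i s' t' j]
    rw [Module.Basis.coord_apply, Module.Basis.coord_apply, Module.Basis.repr_self,
      Module.Basis.repr_self, Finsupp.single_apply, Finsupp.single_apply]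
    refine if_congr ⟨fun h => ?_, fun h => ?_⟩ rfl rfl
    · cases h; rfl
    · cases h; rfl
  exact LinearMap.congr_fun this x

/-- The span of the cell basis elements above `l`. -/
noncomputable def cellUpper (l : Σₗ d, (S d).Λ) : Submodule k A :=
  Submodule.span k {x : A | ∃ μ, l < μ ∧ ∃ s t, x = P.cellBasis S ⟨μ, s, t⟩}

/-- In the lexicographic order every cell of a higher layer lies above every cell of a lower one, so
errors from `higher` are always negligible. -/
theorem block_mem_cellUpper_of_lt {d d' : Δ} (h : d < d') (l : (S d).Λ) (i : I d') (j : J d')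
    (x : B d') : P.block d' i j x ∈ P.cellUpper S ⟨d, l⟩ := by
  have hx : x ∈ Submodule.span k (Set.range (S d').basis) := by
    rw [Module.Basis.span_eq]; trivial
  have hle : Submodule.span k (Set.range (S d').basis) ≤
      (P.cellUpper S ⟨d, l⟩).comap (P.block d' i j) := by
    rw [Submodule.span_le]
    rintro _ ⟨⟨l', s, t⟩, rfl⟩
    refine Submodule.subset_span ⟨⟨d', l'⟩, Sigma.Lex.left _ _ h, (i, s), (t, j), ?_⟩
    rw [P.cellBasis_apply S]
    rfl
  exact hle hx

theorem block_mem_cellUpper {d : Δ} {l : (S d).Λ} (i : I d) (j : J d) {x : B d}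
    (hx : x ∈ (S d).strictUpper l) : P.block d i j x ∈ P.cellUpper S ⟨d, l⟩ := by
  have hle : (S d).strictUpper l ≤ (P.cellUpper S ⟨d, l⟩).comap (P.block d i j) := by
    rw [CellStructure.strictUpper, Submodule.span_le]
    rintro _ ⟨l', hl', s, t, rfl⟩
    refine Submodule.subset_span ⟨⟨d, l'⟩, Sigma.Lex.right _ _ hl', (i, s), (t, j), ?_⟩
    rw [P.cellBasis_apply S]
  exact hle hx

theorem higher_le_cellUpper (d : Δ) (l : (S d).Λ) : P.higher d ≤ P.cellUpper S ⟨d, l⟩ := by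
  rw [higher, Submodule.span_le]
  rintro _ ⟨d', h, i, j, x, rfl⟩
  exact P.block_mem_cellUpper_of_lt S h l i j x

/-- Two expansions are composed: `θ` moves the rows of the layer, then the cell condition in `B d`
expands `θ i i' * C l s t`. Neither sees the column `j` or the index `t`, so the coefficients are
independent of both. -/
theorem left_cell (a : A) (d : Δ) (l : (S d).Λ) :
    ∃ r : I d × (S d).L l → I d × (S d).L l → k, ∀ s (t : (S d).Rt l × J d),
      a * P.cellBasis S ⟨⟨d, l⟩, s, t⟩ - ∑ s', r s s' • P.cellBasis S ⟨⟨d, l⟩, s', t⟩ ∈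
        P.cellUpper S ⟨d, l⟩ := by
  obtain ⟨θ, hθ⟩ := P.exists_left a d
  choose r hr using fun i i' => (S d).left_cell (θ i i') l
  refine ⟨fun x y => r x.1 y.1 x.2 y.2, ?_⟩
  rintro ⟨i, s⟩ ⟨t, j⟩
  have h1 := P.higher_le_cellUpper S d l (hθ i j ((S d).C l s t))
  have h2 : ∀ i', P.block d i' j (θ i i' * (S d).C l s t) -
      ∑ s', r i i' s s' • P.block d i' j ((S d).C l s' t) ∈ P.cellUpper S ⟨d, l⟩ := fun i' => by
    have := P.block_mem_cellUpper S i' j (hr i i' s t)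
    simpa only [map_sub, map_sum, map_smul, CellStructure.C] using this
  have h3 := add_mem h1 (sum_mem fun i' (_ : i' ∈ Finset.univ) => h2 i')
  rw [Finset.sum_sub_distrib, sub_add_sub_cancel] at h3
  simpa only [Fintype.sum_prod_type, P.cellBasis_apply S] using h3

theorem right_cell (a : A) (d : Δ) (l : (S d).Λ) :
    ∃ r : (S d).Rt l × J d → (S d).Rt l × J d → k, ∀ (s : I d × (S d).L l) t,
      P.cellBasis S ⟨⟨d, l⟩, s, t⟩ * a - ∑ t', r t t' • P.cellBasis S ⟨⟨d, l⟩, s, t'⟩ ∈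
        P.cellUpper S ⟨d, l⟩ := by
  obtain ⟨θ, hθ⟩ := P.exists_right a d
  choose r hr using fun j j' => (S d).right_cell (θ j j') l
  refine ⟨fun x y => r x.2 y.2 x.1 y.1, ?_⟩
  rintro ⟨i, s⟩ ⟨t, j⟩
  have h1 := P.higher_le_cellUpper S d l (hθ i j ((S d).C l s t))
  have h2 : ∀ j', P.block d i j' ((S d).C l s t * θ j j') -
      ∑ t', r j j' t t' • P.block d i j' ((S d).C l s t') ∈ P.cellUpper S ⟨d, l⟩ := fun j' => by
    have := P.block_mem_cellUpper S i j' (hr j j' s t)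
    simpa only [map_sub, map_sum, map_smul, CellStructure.C] using this
  have h3 := add_mem h1 (sum_mem fun j' (_ : j' ∈ Finset.univ) => h2 j')
  rw [Finset.sum_sub_distrib, sub_add_sub_cancel] at h3
  simpa only [Fintype.sum_prod_type_right, P.cellBasis_apply S] using h3

/-- An iterated inflation of cell algebras is a cell algebra. -/
noncomputable def cellStructure : CellStructure.{max v₁ v₂} k A where
  Λ := Σₗ d, (S d).Λ
  finite := inferInstanceAs (Finite (Σ d, (S d).Λ))
  L l := I l.1 × (S l.1).L l.2
  Rt l := (S l.1).Rt l.2 × J l.1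
  basis := P.cellBasis S
  left_cell a l := P.left_cell S a l.1 l.2
  right_cell a l := P.right_cell S a l.1 l.2

/-- An iterated inflation of cell algebras with nonzero brackets has nonzero brackets, if each
layer has a pair of positions through which multiplication is given by a unit. -/
theorem isQuasiHereditary (hS : ∀ d, (S d).Λ₀ = Set.univ)
    (hP : ∀ d, ∃ i₀ j₀ p, IsUnit p ∧ ∀ i j x y,
      P.block d i j₀ x * P.block d i₀ j y - P.block d i j (x * p * y) ∈ P.higher d) :
    IsQuasiHereditary k A := by
  refine (P.cellStructure S).isQuasiHereditary (Set.eq_univ_of_forall ?_)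
  rintro ⟨d, l⟩
  obtain ⟨i₀, j₀, p, hp, hmul⟩ := hP d
  obtain ⟨s', t, s, t', hne⟩ := (S d).exists_coord_mul_unit_mul_ne_zero
    (l := l) (by rw [hS]; trivial) hp
  refine (P.cellStructure S).mem_Λ₀_of_gram_ne_zero (l := ⟨d, l⟩) (t := (t, j₀)) (s := (i₀, s))
    fun h0 => hne ?_
  -- The outer row and column may be chosen freely. A zero bracket would put this product, hence the
  -- block of `C l s' t * p * C l s t'`, into the span of higher cells, against `hne`.
  have h1 := (P.cellStructure S).gram_spec ⟨d, l⟩ (i₀, s') (t, j₀) (i₀, s) (t', j₀)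
  rw [h0, zero_smul, sub_zero] at h1
  have h2 : P.block d i₀ j₀ ((S d).C l s' t) * P.block d i₀ j₀ ((S d).C l s t') ∈
      (P.cellStructure S).strictUpper ⟨d, l⟩ := by
    rw [← P.cellBasis_apply S, ← P.cellBasis_apply S]
    exact h1
  have h3 := P.higher_le_cellUpper S d l (hmul i₀ j₀ ((S d).C l s' t) ((S d).C l s t'))
  have h4 := (Submodule.sub_mem_iff_right _ h2).1 h3
  have h5 := (P.cellStructure S).coord_strictUpper ⟨d, l⟩ (i₀, s') (t', j₀) h4
  rw [← P.coord_cellBasis_block S d l i₀ s' t' j₀]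
  exact h5

end IteratedInflation

/-! ### Green's relations and stability in finite monoids -/

section Green

variable {M : Type*} [Monoid M] {x y z : M}

theorem GreenL.mul_right (h : GreenL x y) (a : M) : GreenL (x * a) (y * a) := by
  obtain ⟨⟨b, rfl⟩, c, hc⟩ := greenL_iff.1 h
  exact greenL_iff.2 ⟨⟨b, by rw [mul_assoc]⟩, c, by rw [← mul_assoc, hc]⟩

theorem GreenR.mul_left (h : GreenR x y) (a : M) : GreenR (a * x) (a * y) := by
  obtain ⟨⟨b, rfl⟩, c, hc⟩ := greenR_iff.1 h
  exact greenR_iff.2 ⟨⟨b, by rw [mul_assoc]⟩, c, by rw [mul_assoc, hc]⟩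

theorem GreenR.refl (x : M) : GreenR x x := rfl
theorem GreenL.symm (h : GreenL x y) : GreenL y x := Eq.symm h
theorem GreenR.symm (h : GreenR x y) : GreenR y x := Eq.symm h
theorem GreenL.trans (h : GreenL x y) (h' : GreenL y z) : GreenL x z := Eq.trans h h'
theorem GreenR.trans (h : GreenR x y) (h' : GreenR y z) : GreenR x z := Eq.trans h h'
theorem GreenD.symm (h : GreenD x y) : GreenD y x := greenD_equivalence.symm h
theorem GreenD.trans (h : GreenD x y) (h' : GreenD y z) : GreenD x z :=
  greenD_equivalence.trans h h'
theorem GreenL.greenD (h : GreenL x y) : GreenD x y := ⟨y, h, rfl⟩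
theorem GreenR.greenD (h : GreenR x y) : GreenD x y := ⟨x, rfl, h⟩

theorem GreenL.of_mul_mul {a b : M} (h : b * (a * x) = x) : GreenL (a * x) x :=
  greenL_iff.2 ⟨⟨a, rfl⟩, b, h⟩

theorem GreenR.of_mul_mul {a b : M} (h : x * a * b = x) : GreenR (x * a) x :=
  greenR_iff.2 ⟨⟨a, rfl⟩, b, h⟩

/-- Left multipliers fixing `y` fix everything below `y` in the `𝓡`-order. -/
theorem GreenR.mul_mul_eq (h : GreenR x y) {a b : M} (hy : b * (a * y) = y) :
    b * (a * x) = x := by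
  obtain ⟨⟨c, rfl⟩, -⟩ := greenR_iff.1 h
  rw [← mul_assoc a, ← mul_assoc b, hy]

/-- Right multipliers fixing `y` fix everything below `y` in the `𝓛`-order. -/
theorem GreenL.mul_mul_eq (h : GreenL x y) {a b : M} (hy : y * a * b = y) :
    x * a * b = x := by
  obtain ⟨⟨c, rfl⟩, -⟩ := greenL_iff.1 h
  rw [mul_assoc c, mul_assoc c, hy]

theorem GreenD.exists_mul_mul_eq (h : GreenD x y) : ∃ p q, p * x * q = y := by
  obtain ⟨z, h1, h2⟩ := h
  obtain ⟨-, p, rfl⟩ := greenL_iff.1 h1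
  obtain ⟨-, q, hq⟩ := greenR_iff.1 h2
  exact ⟨p, q, hq⟩

variable [Finite M]

/-- Iteration gives `p ^ m * x * q ^ m = x` for all `m`. By finiteness some `p ^ (d + 1) * p ^ m = p
^ m`, and multiplying `x = p ^ m * x * q ^ m` by `p ^ (d + 1)` shows that it fixes `x`; similarly
for `q`. -/
theorem exists_pow_fix {p q : M} (h : p * x * q = x) :
    (∃ n, p ^ (n + 1) * x = x) ∧ ∃ n, x * q ^ (n + 1) = x := by
  have hn : ∀ n, p ^ n * x * q ^ n = x := by
    intro n
    induction n with
    | zero => simp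
    | succ n ih =>
      calc p ^ (n + 1) * x * q ^ (n + 1) = p ^ n * (p * x * q) * q ^ n := by
            rw [pow_succ, pow_succ']; simp only [mul_assoc]
        _ = x := by rw [h, ih]
  constructor
  · obtain ⟨m, n, hmn, e⟩ := Finite.exists_ne_map_eq_of_infinite (fun n : ℕ => p ^ n)
    wlog hlt : m < n generalizing m n
    · exact this n m hmn.symm e.symm (lt_of_le_of_ne (not_lt.1 hlt) hmn.symm)
    obtain ⟨d, rfl⟩ := Nat.exists_eq_add_of_lt hlt
    refine ⟨d, ?_⟩
    have e' : p ^ (d + 1) * p ^ m = p ^ m := by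
      rw [← pow_add, show d + 1 + m = m + d + 1 by ring]
      exact e.symm
    calc p ^ (d + 1) * x = (p ^ (d + 1) * p ^ m) * x * q ^ m := by
          conv_lhs => rw [← hn m]
          simp only [mul_assoc]
      _ = x := by rw [e', hn]
  · obtain ⟨m, n, hmn, e⟩ := Finite.exists_ne_map_eq_of_infinite (fun n : ℕ => q ^ n)
    wlog hlt : m < n generalizing m n
    · exact this n m hmn.symm e.symm (lt_of_le_of_ne (not_lt.1 hlt) hmn.symm)
    obtain ⟨d, rfl⟩ := Nat.exists_eq_add_of_lt hlt
    refine ⟨d, ?_⟩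
    have e' : q ^ m * q ^ (d + 1) = q ^ m := by
      rw [← pow_add, ← add_assoc]
      exact e.symm
    calc x * q ^ (d + 1) = p ^ m * x * (q ^ m * q ^ (d + 1)) := by
          conv_lhs => rw [← hn m]
          simp only [mul_assoc]
      _ = x := by rw [e', hn]

/-- Finite monoids are left stable. -/
theorem GreenL.of_mul {a p q : M} (h : p * (a * x) * q = x) : GreenL (a * x) x := by
  rw [← mul_assoc] at h
  obtain ⟨⟨n, hn⟩, -⟩ := exists_pow_fix h
  refine GreenL.of_mul_mul (b := (p * a) ^ n * p) ?_
  rw [pow_succ] at hn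
  simpa only [mul_assoc] using hn

/-- Finite monoids are right stable. -/
theorem GreenR.of_mul {a p q : M} (h : p * (x * a) * q = x) : GreenR (x * a) x := by
  rw [← mul_assoc, mul_assoc] at h
  obtain ⟨-, n, hn⟩ := exists_pow_fix h
  refine GreenR.of_mul_mul (b := q * (a * q) ^ n) ?_
  rw [pow_succ'] at hn
  simpa only [mul_assoc] using hn

/-- Stability as used below: a left factor that does not leave the `𝓓`-class can change only the
row. -/
theorem GreenD.greenL_of_mul {a : M} (h : GreenD (a * x) x) : GreenL (a * x) x := by
  obtain ⟨p, q, h⟩ := h.exists_mul_mul_eq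
  exact GreenL.of_mul h

theorem GreenD.greenR_of_mul {a : M} (h : GreenD (x * a) x) : GreenR (x * a) x := by
  obtain ⟨p, q, h⟩ := h.exists_mul_mul_eq
  exact GreenR.of_mul h

/-- In a finite monoid, `𝓙 ⊆ 𝓓`. -/
theorem GreenD.of_mul_mul_eq {p q r s : M} (h : p * x * q = y) (h' : r * y * s = x) :
    GreenD y x := by
  subst h
  have h1 : GreenL (p * x) x := GreenL.of_mul (p := r) (q := q * s) (by
    simpa only [mul_assoc] using h')
  have h2 : GreenR (x * q) x := GreenR.of_mul (p := r * p) (q := s) (by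
    simpa only [mul_assoc] using h')
  exact ⟨x * q, h1.mul_right q, h2⟩

end Green

/-! ### The poset of `𝓓`-classes -/

section DClassOrder

variable {M : Type*} [Monoid M]

theorem DClass.mk_eq_mk {x y : M} : DClass.mk x = DClass.mk y ↔ GreenD x y :=
  Quotient.eq (r := greenDSetoid M)

variable [Finite M]

instance : Finite (DClass M) := inferInstanceAs (Finite (Quotient (greenDSetoid M)))

/-- The reversed `𝓙`-order on the `𝓓`-classes of a finite monoid. -/
instance : PartialOrder (DClass M) where
  le D D' := ∃ x y, DClass.mk x = D ∧ DClass.mk y = D' ∧ ∃ p q, p * x * q = y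
  le_refl D := by
    obtain ⟨x, rfl⟩ := Quotient.exists_rep D
    exact ⟨x, x, rfl, rfl, 1, 1, by simp⟩
  le_trans := by
    rintro _ _ _ ⟨x, y, rfl, rfl, p, q, rfl⟩ ⟨y', z, h, rfl, r, s, rfl⟩
    obtain ⟨t, u, rfl⟩ := (DClass.mk_eq_mk.1 h.symm).exists_mul_mul_eq
    exact ⟨x, _, rfl, rfl, r * t * p, q * u * s, by simp only [mul_assoc]⟩
  le_antisymm := by
    rintro _ _ ⟨x, y, rfl, rfl, p, q, hp⟩ ⟨y', x', h, h', r, s, hr⟩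
    obtain ⟨t, u, ht⟩ := (DClass.mk_eq_mk.1 h.symm).exists_mul_mul_eq
    obtain ⟨t', u', ht'⟩ := (DClass.mk_eq_mk.1 h').exists_mul_mul_eq
    refine (DClass.mk_eq_mk.2 (GreenD.of_mul_mul_eq hp (r := t' * r * t) (s := u * s * u') ?_)).symm
    rw [← ht', ← hr, ← ht]
    simp only [mul_assoc]

theorem DClass.mk_lt_mk {x y p q : M} (h : p * x * q = y) (hD : ¬ GreenD y x) :
    DClass.mk x < DClass.mk y :=
  lt_of_le_of_ne ⟨x, y, rfl, rfl, p, q, h⟩ fun e => hD (DClass.mk_eq_mk.1 e).symm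

end DClassOrder

/-! ### Row, column and group coordinates in a `𝓓`-class -/

section Coordinates

universe v₃

variable {M : Type v₃} [Monoid M]

/-- The `𝓡`-relation on the `𝓛`-class of `γ`. -/
def rowSetoid (γ : M) : Setoid {z : M // GreenL z γ} :=
  ⟨fun z w => GreenR (z : M) w, ⟨fun _ => rfl, fun h => h.symm, fun h h' => h.trans h'⟩⟩

/-- The `𝓛`-relation on the `𝓡`-class of `γ`. -/
def colSetoid (γ : M) : Setoid {z : M // GreenR z γ} :=
  ⟨fun z w => GreenL (z : M) w, ⟨fun _ => rfl, fun h => h.symm, fun h h' => h.trans h'⟩⟩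

/-- The `𝓡`-classes in the `𝓓`-class of `γ`, given by their traces on the `𝓛`-class of `γ`. -/
def GreenRow (γ : M) : Type v₃ := Quotient (rowSetoid γ)

/-- The `𝓛`-classes in the `𝓓`-class of `γ`, given by their traces on the `𝓡`-class of `γ`. -/
def GreenCol (γ : M) : Type v₃ := Quotient (colSetoid γ)

noncomputable instance [Finite M] (γ : M) : Fintype (GreenRow γ) :=
  have : Finite (GreenRow γ) := inferInstanceAs (Finite (Quotient (rowSetoid γ)))
  Fintype.ofFinite _

noncomputable instance [Finite M] (γ : M) : Fintype (GreenCol γ) :=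
  have : Finite (GreenCol γ) := inferInstanceAs (Finite (Quotient (colSetoid γ)))
  Fintype.ofFinite _

variable {γ : M}

theorem GreenRow.exists_mul (i : GreenRow γ) : ∃ u : M, u * γ = (Quotient.out i).1 :=
  (greenL_iff.1 (Quotient.out i).2).1

theorem GreenCol.exists_mul (j : GreenCol γ) : ∃ v : M, γ * v = (Quotient.out j).1 :=
  (greenR_iff.1 (Quotient.out j).2).1

/-- A left multiplier moving `γ` to the row `i`. -/
noncomputable def GreenRow.mult (i : GreenRow γ) : M := i.exists_mul.choose

/-- A right multiplier moving `γ` to the column `j`. -/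
noncomputable def GreenCol.mult (j : GreenCol γ) : M := j.exists_mul.choose

theorem GreenRow.mult_mul (i : GreenRow γ) : i.mult * γ = (Quotient.out i).1 :=
  i.exists_mul.choose_spec

theorem GreenCol.mul_mult (j : GreenCol γ) : γ * j.mult = (Quotient.out j).1 :=
  j.exists_mul.choose_spec

theorem GreenRow.greenL (i : GreenRow γ) : GreenL (i.mult * γ) γ := by
  rw [i.mult_mul]
  exact (Quotient.out i).2

theorem GreenCol.greenR (j : GreenCol γ) : GreenR (γ * j.mult) γ := by
  rw [j.mul_mult]
  exact (Quotient.out j).2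

theorem GreenRow.eq_of_greenR {i i' : GreenRow γ} (h : GreenR (i.mult * γ) (i'.mult * γ)) :
    i = i' := by
  rw [i.mult_mul, i'.mult_mul] at h
  exact Quotient.out_equiv_out.1 h

theorem GreenCol.eq_of_greenL {j j' : GreenCol γ} (h : GreenL (γ * j.mult) (γ * j'.mult)) :
    j = j' := by
  rw [j.mul_mult, j'.mul_mult] at h
  exact Quotient.out_equiv_out.1 h

theorem GreenRow.exists_greenR {z : M} (hz : GreenL z γ) :
    ∃ i : GreenRow γ, GreenR z (i.mult * γ) := by
  let i : GreenRow γ := Quotient.mk (rowSetoid γ) ⟨z, hz⟩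
  refine ⟨i, ?_⟩
  rw [i.mult_mul]
  exact GreenR.symm (Quotient.mk_out (s := rowSetoid γ) ⟨z, hz⟩)

theorem GreenCol.exists_greenL {z : M} (hz : GreenR z γ) :
    ∃ j : GreenCol γ, GreenL z (γ * j.mult) := by
  let j : GreenCol γ := Quotient.mk (colSetoid γ) ⟨z, hz⟩
  refine ⟨j, ?_⟩
  rw [j.mul_mult]
  exact GreenL.symm (Quotient.mk_out (s := colSetoid γ) ⟨z, hz⟩)

theorem GreenRow.exists_inv (i : GreenRow γ) : ∃ w, w * (i.mult * γ) = γ :=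
  (greenL_iff.1 i.greenL).2

theorem GreenCol.exists_inv (j : GreenCol γ) : ∃ w, γ * j.mult * w = γ :=
  (greenR_iff.1 j.greenR).2

/-- Green's lemma: the multiplier can be undone at `γ`, hence on the whole `𝓡`-class of `γ`. -/
theorem GreenRow.mult_mul_greenL (i : GreenRow γ) {h : M} (hh : GreenR h γ) :
    GreenL (i.mult * h) h := by
  obtain ⟨w, hw⟩ := i.exists_inv
  exact GreenL.of_mul_mul (hh.mul_mul_eq hw)

theorem GreenCol.mul_mult_greenR (j : GreenCol γ) {h : M} (hh : GreenL h γ) :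
    GreenR (h * j.mult) h := by
  obtain ⟨w, hw⟩ := j.exists_inv
  exact GreenR.of_mul_mul (hh.mul_mul_eq hw)

variable [Finite M]

/-- The image of `γ` under an element of the Schützenberger group. -/
noncomputable def schutzPoint (g : SchutzenbergerGroup γ) : M :=
  (MulOpposite.unop g.1 ⟨γ, rfl, rfl⟩ : HClass γ)

theorem schutzPoint_mem (g : SchutzenbergerGroup γ) : schutzPoint g ∈ HClass γ := Subtype.prop _

theorem schutzPoint_greenL (g : SchutzenbergerGroup γ) : GreenL (schutzPoint g) γ := (schutzPoint_mem g).1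

theorem schutzPoint_greenR (g : SchutzenbergerGroup γ) : GreenR (schutzPoint g) γ := (schutzPoint_mem g).2

theorem exists_mul_schutzPoint (g : SchutzenbergerGroup γ) :
    ∃ m, γ * m = schutzPoint g ∧ ∀ h : SchutzenbergerGroup γ, schutzPoint (h * g) = schutzPoint h * m := by
  obtain ⟨_, m, rfl⟩ := g
  exact ⟨m, rfl, fun h => rfl⟩

/-- Left multiplication commutes with the right translations forming the group, so its effect on `γ`
determines its effect on the whole `𝓗`-class. -/
theorem mul_schutzPoint {a u : M} {g : SchutzenbergerGroup γ} (ha : a * γ = u * (schutzPoint g))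
    (h : SchutzenbergerGroup γ) : a * (schutzPoint h) = u * schutzPoint (g * h) := by
  obtain ⟨m, h1, h2⟩ := (exists_mul_schutzPoint h)
  rw [← h1, h2, ← mul_assoc, ha, mul_assoc]

theorem schutzPoint_mul {a v : M} {g : SchutzenbergerGroup γ} (ha : γ * a = schutzPoint g * v)
    (h : SchutzenbergerGroup γ) : (schutzPoint h) * a = schutzPoint (h * g) * v := by
  obtain ⟨m, h1, h2⟩ := (exists_mul_schutzPoint g)
  obtain ⟨⟨b, hb⟩, -⟩ := greenL_iff.1 (schutzPoint_greenL h)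
  rw [h2, ← hb, mul_assoc b, ha, ← h1]
  simp only [mul_assoc]

/-- All elements of the `𝓗`-class are left multiples of `γ`, so a right translation is determined by
its value at `γ`. With `exists_schutzPoint_eq` the action is simply transitive. -/
theorem schutzPoint_injective : Function.Injective (schutzPoint (γ := γ)) := by
  rintro ⟨_, m, rfl⟩ ⟨_, n, rfl⟩ h
  have h' : γ * (m : M) = γ * (n : M) := h
  refine Subtype.ext (MulOpposite.unop_injective (Equiv.ext fun x => Subtype.ext ?_))
  change (x : M) * (m : M) = x * n
  obtain ⟨⟨b, hb⟩, -⟩ := greenL_iff.1 x.2.1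
  rw [← hb, mul_assoc, h', mul_assoc]

theorem exists_schutzPoint_eq {x : M} (hx : x ∈ HClass γ) :
    ∃ g : SchutzenbergerGroup γ, (schutzPoint g) = x := by
  obtain ⟨⟨m, rfl⟩, -⟩ := greenR_iff.1 hx.2
  have hm : m ∈ RT γ := by
    rintro h ⟨h1, h2⟩
    refine ⟨(h1.mul_right m).trans hx.1, ?_⟩
    obtain ⟨⟨a, rfl⟩, -⟩ := greenL_iff.1 h1
    rw [mul_assoc]
    exact (hx.2.mul_left a).trans h2
  exact ⟨⟨rPerm γ ⟨m, hm⟩, ⟨m, hm⟩, rfl⟩, rfl⟩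

theorem GreenRow.exists_eq_mul_point {z : M} (hz : GreenL z γ) :
    ∃ (i : GreenRow γ) (g : SchutzenbergerGroup γ), z = i.mult * (schutzPoint g) := by
  obtain ⟨i, hi⟩ := GreenRow.exists_greenR hz
  obtain ⟨w, hw⟩ := i.exists_inv
  have h1 : i.mult * (w * z) = z := hi.mul_mul_eq (by rw [hw])
  have h2 : GreenL (w * z) z := GreenL.of_mul_mul h1
  have h3 : GreenR (w * z) γ := by
    have := hi.mul_left w
    rwa [hw] at this
  obtain ⟨g, hg⟩ := exists_schutzPoint_eq ⟨h2.trans hz, h3⟩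
  exact ⟨i, g, by rw [hg, h1]⟩

theorem GreenCol.exists_eq_point_mul {z : M} (hz : GreenR z γ) :
    ∃ (j : GreenCol γ) (g : SchutzenbergerGroup γ), z = schutzPoint g * j.mult := by
  obtain ⟨j, hj⟩ := GreenCol.exists_greenL hz
  obtain ⟨w, hw⟩ := j.exists_inv
  have h1 : z * w * j.mult = z := hj.mul_mul_eq (by rw [hw])
  have h2 : GreenR (z * w) z := GreenR.of_mul_mul h1
  have h3 : GreenL (z * w) γ := by
    have := hj.mul_right w
    rwa [hw] at this
  obtain ⟨g, hg⟩ := exists_schutzPoint_eq ⟨h3, h2.trans hz⟩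
  exact ⟨j, g, by rw [hg, h1]⟩

/-- The element of the `𝓓`-class of `γ` with given row, column and group coordinate. -/
noncomputable def greenElement (i : GreenRow γ) (j : GreenCol γ) (g : SchutzenbergerGroup γ) : M :=
  i.mult * (schutzPoint g) * j.mult

theorem GreenRow.mult_point_greenL (i : GreenRow γ) (g : SchutzenbergerGroup γ) :
    GreenL (i.mult * (schutzPoint g)) γ :=
  (i.mult_mul_greenL (schutzPoint_greenR g)).trans (schutzPoint_greenL g)

theorem GreenCol.point_mult_greenR (j : GreenCol γ) (g : SchutzenbergerGroup γ) :
    GreenR ((schutzPoint g) * j.mult) γ :=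
  (j.mul_mult_greenR (schutzPoint_greenL g)).trans (schutzPoint_greenR g)

theorem greenElement_greenR (i : GreenRow γ) (j : GreenCol γ) (g : SchutzenbergerGroup γ) :
    GreenR (greenElement i j g) (i.mult * (schutzPoint g)) :=
  j.mul_mult_greenR (i.mult_point_greenL g)

theorem greenElement_greenL (i : GreenRow γ) (j : GreenCol γ) (g : SchutzenbergerGroup γ) :
    GreenL (greenElement i j g) ((schutzPoint g) * j.mult) := by
  rw [greenElement, mul_assoc]
  exact i.mult_mul_greenL (j.point_mult_greenR g)

theorem greenElement_greenD (i : GreenRow γ) (j : GreenCol γ) (g : SchutzenbergerGroup γ) :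
    GreenD (greenElement i j g) γ :=
  (greenElement_greenR i j g).greenD.trans (i.mult_point_greenL g).greenD

/-- The `𝓡`-class recovers the row and the `𝓛`-class the column; undoing both multipliers then
recovers the group coordinate. -/
theorem greenElement_injective {i i' : GreenRow γ} {j j' : GreenCol γ}
    {g g' : SchutzenbergerGroup γ} (h : greenElement i j g = greenElement i' j' g') :
    i = i' ∧ j = j' ∧ g = g' := by
  obtain rfl : i = i' := by
    refine GreenRow.eq_of_greenR ((((schutzPoint_greenR g).mul_left i.mult).symm.trans
      (greenElement_greenR i j g).symm).trans ?_)
    rw [h]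
    exact (greenElement_greenR i' j' g').trans ((schutzPoint_greenR g').mul_left i'.mult)
  obtain rfl : j = j' := by
    refine GreenCol.eq_of_greenL ((((schutzPoint_greenL g).mul_right j.mult).symm.trans
      (greenElement_greenL i j g).symm).trans ?_)
    rw [h]
    exact (greenElement_greenL i j' g').trans ((schutzPoint_greenL g').mul_right j'.mult)
  refine ⟨rfl, rfl, schutzPoint_injective ?_⟩
  obtain ⟨w, hw⟩ := i.exists_inv
  obtain ⟨w', hw'⟩ := j.exists_inv
  have key : ∀ g : SchutzenbergerGroup γ, w * greenElement i j g * w' = schutzPoint g := fun g => by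
    rw [greenElement, mul_assoc i.mult, (j.point_mult_greenR g).mul_mul_eq hw,
      (schutzPoint_greenL g).mul_mul_eq hw']
  rw [← key g, h, key g']

theorem exists_greenElement_eq {x : M} (hx : GreenD x γ) :
    ∃ (i : GreenRow γ) (j : GreenCol γ) (g : SchutzenbergerGroup γ), greenElement i j g = x := by
  obtain ⟨z, h1, h2⟩ := hx
  obtain ⟨j, g, rfl⟩ := GreenCol.exists_eq_point_mul h2
  obtain ⟨⟨c, rfl⟩, d, hd⟩ := greenL_iff.1 h1
  obtain ⟨w, hw⟩ := j.exists_inv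
  -- `d` undoes `c` on `schutzPoint g * j.mult`; cancelling `j.mult` with `w`, it does so on
  -- `schutzPoint g`. Hence `c * schutzPoint g` lies in the `𝓛`-class of `γ` and has a row
  -- coordinate.
  have h3 : d * (c * (schutzPoint g)) = schutzPoint g := by
    have h4 := (schutzPoint_greenL g).mul_mul_eq hw
    conv_rhs => rw [← h4, ← hd]
    conv_lhs => rw [← h4]
    simp only [mul_assoc]
  obtain ⟨i, g', hi⟩ := GreenRow.exists_eq_mul_point
    ((GreenL.of_mul_mul h3).trans (schutzPoint_greenL g))
  exact ⟨i, j, g', by rw [greenElement, ← hi, mul_assoc]⟩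

/-- In a regular finite monoid, each `𝓓`-class contains products of its own elements. -/
theorem IsRegularMonoid.exists_greenD_mul (hM : IsRegularMonoid M) (γ : M) :
    ∃ (i : GreenRow γ) (j : GreenCol γ), GreenD (γ * j.mult * i.mult * γ) γ := by
  obtain ⟨y, hy⟩ := hM γ
  -- The row of `y * γ` and the column of `γ` work because `γ * (y * γ) = γ` stays in the class.
  have hz : GreenL (y * γ) γ := GreenL.of_mul_mul (b := γ) (by rw [← mul_assoc, ← hy])
  obtain ⟨i, hi⟩ := GreenRow.exists_greenR hz
  obtain ⟨j, hj⟩ := GreenCol.exists_greenL (GreenR.refl γ)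
  obtain ⟨⟨b, hb⟩, -⟩ := greenR_iff.1 hi
  obtain ⟨⟨s, hs⟩, -⟩ := greenL_iff.1 hj
  refine ⟨i, j, GreenD.of_mul_mul_eq (p := γ * j.mult * i.mult) (q := 1) (by simp)
    (r := s) (s := b) ?_⟩
  calc s * (γ * j.mult * i.mult * γ) * b = (s * (γ * j.mult)) * (i.mult * γ * b) := by
        simp only [mul_assoc]
    _ = γ := by rw [hs, hb, ← mul_assoc, ← hy]

end Coordinates

/-! ### Twisting scalars within a `𝓓`-class -/

section Compatible

variable {k M : Type*} [Field k] [Monoid M] {π : Twisting k M}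

/-- The basis element `x` of the twisted monoid algebra. -/
noncomputable def TwistedMonoidAlgebra.of (π : Twisting k M) (x : M) : TwistedMonoidAlgebra π :=
  single π x 1

open TwistedMonoidAlgebra

theorem TwistedMonoidAlgebra.smul_of (a : k) (x : M) : a • of π x = single π x a :=
  (Finsupp.smul_single a x (1 : k)).trans (by rw [smul_eq_mul, mul_one]; rfl)

theorem TwistedMonoidAlgebra.of_mul_of (x y : M) :
    of π x * of π y = π.toFun x y • of π (x * y) := by
  rw [of, of, single_mul_single, smul_of, one_mul, one_mul]

/-- The basis of the twisted monoid algebra formed by its elements. -/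
noncomputable def TwistedMonoidAlgebra.ofBasis (π : Twisting k M) : Module.Basis M k (TwistedMonoidAlgebra π) :=
  Module.Basis.ofRepr (LinearEquiv.refl k (M →₀ k))

theorem TwistedMonoidAlgebra.ofBasis_apply (x : M) : ofBasis π x = of π x := rfl

variable [Finite M] {γ : M}

/-- The product of the basis elements of the factors of `greenElement i j g`. -/
noncomputable def TwistedMonoidAlgebra.greenProduct (π : Twisting k M) (i : GreenRow γ)
    (j : GreenCol γ) (g : SchutzenbergerGroup γ) : TwistedMonoidAlgebra π :=
  of π i.mult * of π (schutzPoint g) * of π j.mult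

namespace Twisting.StronglyCompatible

theorem row_const (hπ : π.StronglyCompatible) (i : GreenRow γ) (g : SchutzenbergerGroup γ) :
    π.toFun i.mult (schutzPoint g) = π.toFun i.mult γ ∧ π.toFun i.mult γ ≠ 0 :=
  hπ.1 i.mult γ i.greenL.greenD _ (schutzPoint_mem g)

theorem col_const (hπ : π.StronglyCompatible) (j : GreenCol γ) (g : SchutzenbergerGroup γ) :
    π.toFun (schutzPoint g) j.mult = π.toFun γ j.mult ∧ π.toFun γ j.mult ≠ 0 :=
  hπ.2 j.mult γ j.greenR.greenD _ (schutzPoint_mem g)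

/-- No partial product leaves the `𝓓`-class, so all scalars are nonzero. The rescaled elements are
the convenient basis: by associativity a left factor meets only the row and group factors, a right
factor only the group and column factors. -/
theorem exists_greenProduct_eq (hπ : π.StronglyCompatible) (i : GreenRow γ)
    (j : GreenCol γ) (g : SchutzenbergerGroup γ) :
    ∃ c : k, c ≠ 0 ∧ greenProduct π i j g = c • of π (greenElement i j g) := by
  have h1 := hπ.row_const i g
  have h2 := hπ.2 j.mult (i.mult * schutzPoint g) (greenElement_greenR i j g).greenD _ ⟨rfl, rfl⟩
  refine ⟨π.toFun i.mult (schutzPoint g) * π.toFun (i.mult * schutzPoint g) j.mult,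
    mul_ne_zero (h1.1 ▸ h1.2) h2.2, ?_⟩
  rw [greenProduct, of_mul_of, smul_mul_assoc, of_mul_of, smul_smul, greenElement]

theorem exists_mul_row (hπ : π.StronglyCompatible) (a : M) (i : GreenRow γ)
    (h : GreenD (a * (i.mult * γ)) γ) :
    ∃ (i' : GreenRow γ) (c : k) (g₀ : SchutzenbergerGroup γ), ∀ g : SchutzenbergerGroup γ,
      of π a * (of π i.mult * of π (schutzPoint g)) =
        c • (of π i'.mult * of π (schutzPoint (g₀ * g))) := by
  have hD := h.trans i.greenL.greenD.symm
  obtain ⟨i', g₀, hg₀⟩ := GreenRow.exists_eq_mul_point (hD.greenL_of_mul.trans i.greenL)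
  -- The first two scalars come from multiplying out the left side, the inverse from splitting the
  -- result into row and group factors again. All three are evaluated at `γ`, hence independent of
  -- `g`.
  refine ⟨i', π.toFun i.mult γ * π.toFun a (i.mult * γ) * (π.toFun i'.mult γ)⁻¹, g₀, fun g => ?_⟩
  have h1 := hπ.row_const i g
  have h2 := hπ.row_const i' (g₀ * g)
  have hH : i.mult * schutzPoint g ∈ HClass (i.mult * γ) :=
    ⟨(i.mult_point_greenL g).trans i.greenL.symm, (schutzPoint_greenR g).mul_left _⟩
  have h3 := (hπ.1 a (i.mult * γ) hD _ hH).1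
  have h4 : a * (i.mult * schutzPoint g) = i'.mult * schutzPoint (g₀ * g) := by
    rw [← mul_assoc] at hg₀ ⊢
    exact mul_schutzPoint hg₀ g
  rw [of_mul_of, mul_smul_comm, of_mul_of, h1.1, h3, h4, of_mul_of, h2.1, smul_smul, smul_smul,
    inv_mul_cancel_right₀ h2.2]

theorem exists_mul_col (hπ : π.StronglyCompatible) (a : M) (j : GreenCol γ)
    (h : GreenD (γ * j.mult * a) γ) :
    ∃ (j' : GreenCol γ) (c : k) (g₀ : SchutzenbergerGroup γ), ∀ g : SchutzenbergerGroup γ,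
      of π (schutzPoint g) * of π j.mult * of π a =
        c • (of π (schutzPoint (g * g₀)) * of π j'.mult) := by
  have hD := h.trans j.greenR.greenD.symm
  obtain ⟨j', g₀, hg₀⟩ := GreenCol.exists_eq_point_mul (hD.greenR_of_mul.trans j.greenR)
  refine ⟨j', π.toFun γ j.mult * π.toFun (γ * j.mult) a * (π.toFun γ j'.mult)⁻¹, g₀, fun g => ?_⟩
  have h1 := hπ.col_const j g
  have h2 := hπ.col_const j' (g * g₀)
  have hH : schutzPoint g * j.mult ∈ HClass (γ * j.mult) :=
    ⟨(schutzPoint_greenL g).mul_right _, (j.point_mult_greenR g).trans j.greenR.symm⟩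
  have h3 := (hπ.2 a (γ * j.mult) hD _ hH).1
  have h4 : schutzPoint g * j.mult * a = schutzPoint (g * g₀) * j'.mult := by
    rw [mul_assoc] at hg₀ ⊢
    exact schutzPoint_mul hg₀ g
  rw [of_mul_of, smul_mul_assoc, of_mul_of, h1.1, h3, h4, of_mul_of, h2.1, smul_smul, smul_smul,
    inv_mul_cancel_right₀ h2.2]

/-- This is the sandwich entry for column `j` and row `i`. Since the full product stays in the
`𝓓`-class, so do its partial products; the scalars are therefore nonzero and constant in `g` and
`h`. -/
theorem exists_mul_middle (hπ : π.StronglyCompatible) (i : GreenRow γ) (j : GreenCol γ)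
    (h : GreenD (γ * j.mult * i.mult * γ) γ) :
    ∃ (c : k) (g₀ : SchutzenbergerGroup γ), c ≠ 0 ∧ ∀ g h : SchutzenbergerGroup γ,
      of π (schutzPoint g) * of π j.mult * of π i.mult * of π (schutzPoint h) =
        c • of π (schutzPoint (g * g₀ * h)) := by
  obtain ⟨p, q, hpq⟩ := h.exists_mul_mul_eq
  have hD : GreenD (γ * j.mult * i.mult) γ :=
    GreenD.of_mul_mul_eq (p := 1) (q := j.mult * i.mult) (by simp [mul_assoc])
      (r := p) (s := γ * q) (by simpa only [mul_assoc] using hpq)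
  have hR : GreenR (γ * j.mult * i.mult) γ := by
    rw [mul_assoc] at hD ⊢
    exact hD.greenR_of_mul
  have hDj := hD.trans j.greenR.greenD.symm
  have hH : γ * j.mult * i.mult * γ ∈ HClass γ := by
    refine ⟨h.greenL_of_mul, ?_⟩
    simp only [mul_assoc] at h ⊢
    exact h.greenR_of_mul
  obtain ⟨g₀, hg₀⟩ := exists_schutzPoint_eq hH
  have h3 := hπ.2 i.mult (γ * j.mult) hDj
  have h4 := hπ.2 γ (γ * j.mult * i.mult) (h.trans hD.symm)
  refine ⟨π.toFun γ j.mult * π.toFun (γ * j.mult) i.mult * π.toFun (γ * j.mult * i.mult) γ, g₀,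
    mul_ne_zero (mul_ne_zero (hπ.col_const j 1).2 (h3 _ ⟨rfl, rfl⟩).2) (h4 _ ⟨rfl, rfl⟩).2,
    fun g h' => ?_⟩
  have hL1 : GreenL (schutzPoint g * j.mult * i.mult) (γ * j.mult * i.mult) :=
    ((schutzPoint_greenL g).mul_right _).mul_right _
  have hR1 : GreenR (schutzPoint g * j.mult * i.mult) (schutzPoint g * j.mult) :=
    ((hL1.greenD.trans hD).trans (j.point_mult_greenR g).greenD.symm).greenR_of_mul
  have e1 := (hπ.col_const j g).1
  have e2 := (h3 (schutzPoint g * j.mult)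
    ⟨(schutzPoint_greenL g).mul_right _, (j.point_mult_greenR g).trans j.greenR.symm⟩).1
  have e3 := (h4 (schutzPoint g * j.mult * i.mult)
    ⟨hL1, (hR1.trans (j.point_mult_greenR g)).trans hR.symm⟩).1
  -- The last scalar depends on both group coordinates. Condition (1) replaces `schutzPoint h'` by
  -- `γ` in the second argument; `e3`, from condition (2), then does so for `schutzPoint g` in the
  -- first.
  have e4 := (hπ.1 (schutzPoint g * j.mult * i.mult) γ ((hL1.mul_right γ).greenD.trans h)
    (schutzPoint h') (schutzPoint_mem h')).1
  have e5 : schutzPoint g * (j.mult * i.mult * γ) = schutzPoint (g * g₀) * 1 :=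
    schutzPoint_mul (by rw [hg₀]; simp only [mul_assoc, mul_one]) g
  have e6 : schutzPoint g * j.mult * i.mult * schutzPoint h' = 1 * schutzPoint (g * g₀ * h') :=
    mul_schutzPoint (by rw [one_mul, ← mul_one (schutzPoint (g * g₀)), ← e5]
                        simp only [mul_assoc]) h'
  rw [one_mul] at e6
  rw [of_mul_of, smul_mul_assoc, of_mul_of, smul_mul_assoc, smul_mul_assoc, of_mul_of, e1, e2, e4,
    e3, e6, smul_smul, smul_smul]

end Twisting.StronglyCompatible

end Compatible

/-! ### The twisted monoid algebra as an iterated inflation -/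

section Inflation

variable {k M : Type*} [Field k] [Monoid M] [Finite M] {π : Twisting k M}
  {γ : DClass M → M}

theorem greenElement_bijective (hγ : ∀ D : DClass M, DClass.mk (γ D) = D) :
    Function.Bijective fun x : Σ q : Σ D, GreenRow (γ D) × GreenCol (γ D),
      SchutzenbergerGroup (γ q.1) => greenElement x.1.2.1 x.1.2.2 x.2 := by
  constructor
  · rintro ⟨⟨D, i, j⟩, g⟩ ⟨⟨D', i', j'⟩, g'⟩ h
    replace h : greenElement i j g = greenElement i' j' g' := h
    obtain rfl : D = D' := by
      rw [← hγ D, ← hγ D', DClass.mk_eq_mk]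
      refine (greenElement_greenD i j g).symm.trans ?_
      rw [h]
      exact greenElement_greenD i' j' g'
    obtain ⟨rfl, rfl, rfl⟩ := greenElement_injective h
    rfl
  · intro x
    obtain ⟨i, j, g, h⟩ := exists_greenElement_eq (γ := γ (DClass.mk x)) (x := x)
      (DClass.mk_eq_mk.1 (hγ _).symm)
    exact ⟨⟨⟨_, i, j⟩, g⟩, h⟩

namespace TwistedMonoidAlgebra

open Twisting

/-- The basis of the twisted monoid algebra given by row, column and group coordinates. -/
noncomputable def greenBasis (hπ : π.StronglyCompatible)
    (hγ : ∀ D : DClass M, DClass.mk (γ D) = D) :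
    Module.Basis (Σ q : Σ D, GreenRow (γ D) × GreenCol (γ D), SchutzenbergerGroup (γ q.1)) k
      (TwistedMonoidAlgebra π) :=
  ((ofBasis π).reindex (Equiv.ofBijective _ (greenElement_bijective hγ)).symm).isUnitSMul
    fun x => (hπ.exists_greenProduct_eq x.1.2.1 x.1.2.2 x.2).choose_spec.1.isUnit

theorem greenBasis_apply (hπ : π.StronglyCompatible) (hγ : ∀ D : DClass M, DClass.mk (γ D) = D)
    (D : DClass M) (i : GreenRow (γ D)) (j : GreenCol (γ D)) (g : SchutzenbergerGroup (γ D)) :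
    greenBasis hπ hγ ⟨⟨D, i, j⟩, g⟩ = greenProduct π i j g := by
  rw [greenBasis, Module.Basis.isUnitSMul_apply, Module.Basis.reindex_apply, Equiv.symm_symm,
    Equiv.ofBijective_apply, ofBasis_apply]
  exact (hπ.exists_greenProduct_eq i j g).choose_spec.2.symm

/-- The decomposition of the twisted monoid algebra into copies of the group algebras of the
Schützenberger groups, indexed by rows and columns. -/
noncomputable def greenEquiv (hπ : π.StronglyCompatible)
    (hγ : ∀ D : DClass M, DClass.mk (γ D) = D) :
    (∀ q : Σ D, GreenRow (γ D) × GreenCol (γ D), MonoidAlgebra k (SchutzenbergerGroup (γ q.1))) ≃ₗ[k]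
      TwistedMonoidAlgebra π :=
  have : Fintype (DClass M) := Fintype.ofFinite _
  (Pi.basis fun q : Σ D, GreenRow (γ D) × GreenCol (γ D) =>
    MonoidAlgebra.basis (SchutzenbergerGroup (γ q.1)) k).equiv (greenBasis hπ hγ) (Equiv.refl _)

open Classical in
/-- The copy of the group algebra at row `i` and column `j`. -/
noncomputable def greenBlock (hπ : π.StronglyCompatible)
    (hγ : ∀ D : DClass M, DClass.mk (γ D) = D) (D : DClass M) (i : GreenRow (γ D))
    (j : GreenCol (γ D)) :
    MonoidAlgebra k (SchutzenbergerGroup (γ D)) →ₗ[k] TwistedMonoidAlgebra π :=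
  (greenEquiv hπ hγ).toLinearMap ∘ₗ LinearMap.single k
    (fun q : Σ D, GreenRow (γ D) × GreenCol (γ D) =>
      MonoidAlgebra k (SchutzenbergerGroup (γ q.1))) ⟨D, i, j⟩

variable (hπ : π.StronglyCompatible) (hγ : ∀ D : DClass M, DClass.mk (γ D) = D)

theorem greenBlock_single (D : DClass M) (i : GreenRow (γ D))
    (j : GreenCol (γ D)) (g : SchutzenbergerGroup (γ D)) :
    greenBlock hπ hγ D i j (MonoidAlgebra.single g 1) = greenProduct π i j g := by
  classical
  let _ : Fintype (DClass M) := Fintype.ofFinite _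
  rw [← greenBasis_apply hπ hγ]
  have h := (Pi.basis fun q : Σ D, GreenRow (γ D) × GreenCol (γ D) =>
    MonoidAlgebra.basis (SchutzenbergerGroup (γ q.1)) k).equiv_apply ⟨⟨D, i, j⟩, g⟩
      (greenBasis hπ hγ) (Equiv.refl _)
  rw [Pi.basis_apply] at h
  exact h

/-- The span of the blocks above `D`. -/
noncomputable def greenHigher (D : DClass M) : Submodule k (TwistedMonoidAlgebra π) :=
  Submodule.span k {y | ∃ D', D < D' ∧ ∃ i j x, y = greenBlock hπ hγ D' i j x}

theorem of_mem_greenHigher {D : DClass M} {x : M} (h : D < DClass.mk x) :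
    of π x ∈ greenHigher hπ hγ D := by
  obtain ⟨i, j, g, hg⟩ := exists_greenElement_eq (γ := γ (DClass.mk x)) (x := x)
      (DClass.mk_eq_mk.1 (hγ _).symm)
  obtain ⟨c, hc, e⟩ := hπ.exists_greenProduct_eq i j g
  have h1 : greenProduct π i j g ∈ greenHigher hπ hγ D :=
    Submodule.subset_span ⟨_, h, i, j, _, (greenBlock_single hπ hγ _ i j g).symm⟩
  rw [e, hg] at h1
  have := Submodule.smul_mem _ c⁻¹ h1
  rwa [smul_smul, inv_mul_cancel₀ hc, one_smul] at this

theorem _root_.LinearMap.forall_mem_of_single {G V : Type*} [Monoid G] [AddCommGroup V] [Module k V]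
    (Φ : MonoidAlgebra k G →ₗ[k] V) (N : Submodule k V)
    (h : ∀ g, Φ (MonoidAlgebra.single g 1) ∈ N) (x : MonoidAlgebra k G) : Φ x ∈ N := by
  have hle : Submodule.span k (Set.range (MonoidAlgebra.basis G k)) ≤ N.comap Φ := by
    rw [Submodule.span_le]
    rintro _ ⟨g, rfl⟩
    exact h g
  rw [Module.Basis.span_eq] at hle
  exact hle (Submodule.mem_top (x := x))

/-- Whether `a` leaves `D` depends only on the row: the product is a right multiple of `a * i.mult *
γ D`, so if it stayed in `D`, that element would too. The twisting scalar may vanish here, which is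
harmless. -/
theorem of_mul_greenBlock_mem (a : M) (D : DClass M) (i : GreenRow (γ D))
    (h : ¬ GreenD (a * (i.mult * γ D)) (γ D)) (j : GreenCol (γ D))
    (x : MonoidAlgebra k (SchutzenbergerGroup (γ D))) :
    of π a * greenBlock hπ hγ D i j x ∈ greenHigher hπ hγ D := by
  refine LinearMap.forall_mem_of_single
    (LinearMap.mulLeft k (of π a) ∘ₗ greenBlock hπ hγ D i j) _ (fun g => ?_) x
  rw [LinearMap.comp_apply, LinearMap.mulLeft_apply, greenBlock_single]
  obtain ⟨c, -, e⟩ := hπ.exists_greenProduct_eq i j g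
  rw [e, mul_smul_comm, of_mul_of]
  refine Submodule.smul_mem _ _ (Submodule.smul_mem _ _ (of_mem_greenHigher hπ hγ ?_))
  obtain ⟨m, hm, -⟩ := exists_mul_schutzPoint g
  have e' : a * greenElement i j g = a * i.mult * γ D * (m * j.mult) := by
    rw [greenElement, ← hm]; simp only [mul_assoc]
  rw [e']
  conv_lhs => rw [← hγ D]
  refine DClass.mk_lt_mk (p := a * i.mult) (q := m * j.mult) rfl fun hD => h ?_
  obtain ⟨p, q, hpq⟩ := hD.exists_mul_mul_eq
  exact GreenD.of_mul_mul_eq (p := a * i.mult) (q := 1) (by simp only [mul_assoc, mul_one])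
    (r := p) (s := m * j.mult * q) (by simpa only [mul_assoc] using hpq)

theorem greenBlock_mul_of_mem (a : M) (D : DClass M) (i : GreenRow (γ D)) (j : GreenCol (γ D))
    (h : ¬ GreenD (γ D * j.mult * a) (γ D))
    (x : MonoidAlgebra k (SchutzenbergerGroup (γ D))) :
    greenBlock hπ hγ D i j x * of π a ∈ greenHigher hπ hγ D := by
  refine LinearMap.forall_mem_of_single
    (LinearMap.mulRight k (of π a) ∘ₗ greenBlock hπ hγ D i j) _ (fun g => ?_) x
  rw [LinearMap.comp_apply, LinearMap.mulRight_apply, greenBlock_single]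
  obtain ⟨c, -, e⟩ := hπ.exists_greenProduct_eq i j g
  rw [e, smul_mul_assoc, of_mul_of]
  refine Submodule.smul_mem _ _ (Submodule.smul_mem _ _ (of_mem_greenHigher hπ hγ ?_))
  obtain ⟨⟨b, hb⟩, -⟩ := greenL_iff.1 (schutzPoint_greenL g)
  have e' : greenElement i j g * a = i.mult * b * γ D * (j.mult * a) := by
    rw [greenElement, ← hb]; simp only [mul_assoc]
  rw [e']
  conv_lhs => rw [← hγ D]
  refine DClass.mk_lt_mk (p := i.mult * b) (q := j.mult * a) rfl fun hD => h ?_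
  obtain ⟨p, q, hpq⟩ := hD.exists_mul_mul_eq
  exact GreenD.of_mul_mul_eq (p := 1) (q := j.mult * a) (by simp only [mul_assoc, one_mul])
    (r := p * i.mult * b) (s := q) (by simpa only [mul_assoc] using hpq)

/-- For a monoid element, `θ i` has at most one nonzero entry: a multiple of the translation `g₀` at
the new row if the row stays in `D`, and nothing otherwise. Linearity does the rest. -/
theorem exists_left_action (a : TwistedMonoidAlgebra π) (D : DClass M) :
    ∃ θ : GreenRow (γ D) → GreenRow (γ D) → MonoidAlgebra k (SchutzenbergerGroup (γ D)),
      ∀ i j x, a * greenBlock hπ hγ D i j x - ∑ i', greenBlock hπ hγ D i' j (θ i i' * x) ∈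
        greenHigher hπ hγ D := by
  classical
  induction a using induction_on with
  | zero => exact ⟨0, fun i j x => by simp⟩
  | add a b ha hb =>
    obtain ⟨θ, hθ⟩ := ha
    obtain ⟨η, hη⟩ := hb
    refine ⟨θ + η, fun i j x => ?_⟩
    convert add_mem (hθ i j x) (hη i j x) using 1
    simp only [Pi.add_apply, add_mul, map_add, Finset.sum_add_distrib]
    abel
  | base a α =>
    suffices h : ∀ i, ∃ θ : GreenRow (γ D) → MonoidAlgebra k (SchutzenbergerGroup (γ D)),
        ∀ j x, of π a * greenBlock hπ hγ D i j x - ∑ i', greenBlock hπ hγ D i' j (θ i' * x) ∈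
          greenHigher hπ hγ D by
      choose θ hθ using h
      refine ⟨fun i i' => α • θ i i', fun i j x => ?_⟩
      convert Submodule.smul_mem _ α (hθ i j x) using 1
      rw [← smul_of]
      simp only [smul_mul_assoc, map_smul, smul_sub, Finset.smul_sum]
    intro i
    by_cases h : GreenD (a * (i.mult * γ D)) (γ D)
    · obtain ⟨i', c, g₀, hg₀⟩ := hπ.exists_mul_row a i h
      refine ⟨fun i'' => if i'' = i' then MonoidAlgebra.single g₀ c else 0, fun j x => ?_⟩
      simp only [ite_mul, zero_mul, apply_ite (greenBlock hπ hγ D _ j), map_zero,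
        Finset.sum_ite_eq', Finset.mem_univ, if_true]
      refine LinearMap.forall_mem_of_single (LinearMap.mulLeft k (of π a) ∘ₗ greenBlock hπ hγ D i j -
        greenBlock hπ hγ D i' j ∘ₗ LinearMap.mulLeft k (MonoidAlgebra.single g₀ c)) _
        (fun g => ?_) x
      have e : (MonoidAlgebra.single g₀ c * MonoidAlgebra.single g 1 :
          MonoidAlgebra k (SchutzenbergerGroup (γ D))) = c • MonoidAlgebra.single (g₀ * g) 1 := by
        rw [MonoidAlgebra.single_mul_single, MonoidAlgebra.smul_single, smul_eq_mul]
      rw [LinearMap.sub_apply, LinearMap.comp_apply, LinearMap.comp_apply, LinearMap.mulLeft_apply,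
        LinearMap.mulLeft_apply, e, map_smul, greenBlock_single, greenBlock_single, greenProduct,
        greenProduct, ← mul_assoc, hg₀, smul_mul_assoc, sub_self]
      exact zero_mem _
    · exact ⟨0, fun j x => by simpa using of_mul_greenBlock_mem hπ hγ a D i h j x⟩

theorem exists_right_action (a : TwistedMonoidAlgebra π) (D : DClass M) :
    ∃ θ : GreenCol (γ D) → GreenCol (γ D) → MonoidAlgebra k (SchutzenbergerGroup (γ D)),
      ∀ i j x, greenBlock hπ hγ D i j x * a - ∑ j', greenBlock hπ hγ D i j' (x * θ j j') ∈
        greenHigher hπ hγ D := by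
  classical
  induction a using induction_on with
  | zero => exact ⟨0, fun i j x => by simp⟩
  | add a b ha hb =>
    obtain ⟨θ, hθ⟩ := ha
    obtain ⟨η, hη⟩ := hb
    refine ⟨θ + η, fun i j x => ?_⟩
    convert add_mem (hθ i j x) (hη i j x) using 1
    simp only [Pi.add_apply, mul_add, map_add, Finset.sum_add_distrib]
    abel
  | base a α =>
    suffices h : ∀ j, ∃ θ : GreenCol (γ D) → MonoidAlgebra k (SchutzenbergerGroup (γ D)),
        ∀ i x, greenBlock hπ hγ D i j x * of π a - ∑ j', greenBlock hπ hγ D i j' (x * θ j') ∈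
          greenHigher hπ hγ D by
      choose θ hθ using h
      refine ⟨fun j j' => α • θ j j', fun i j x => ?_⟩
      convert Submodule.smul_mem _ α (hθ j i x) using 1
      rw [← smul_of]
      simp only [mul_smul_comm, map_smul, smul_sub, Finset.smul_sum]
    intro j
    by_cases h : GreenD (γ D * j.mult * a) (γ D)
    · obtain ⟨j', c, g₀, hg₀⟩ := hπ.exists_mul_col a j h
      refine ⟨fun j'' => if j'' = j' then MonoidAlgebra.single g₀ c else 0, fun i x => ?_⟩
      simp only [mul_ite, mul_zero, apply_ite (greenBlock hπ hγ D i _), map_zero,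
        Finset.sum_ite_eq', Finset.mem_univ, if_true]
      refine LinearMap.forall_mem_of_single (LinearMap.mulRight k (of π a) ∘ₗ greenBlock hπ hγ D i j -
        greenBlock hπ hγ D i j' ∘ₗ LinearMap.mulRight k (MonoidAlgebra.single g₀ c)) _
        (fun g => ?_) x
      have e : (MonoidAlgebra.single g 1 * MonoidAlgebra.single g₀ c :
          MonoidAlgebra k (SchutzenbergerGroup (γ D))) = c • MonoidAlgebra.single (g * g₀) 1 := by
        rw [MonoidAlgebra.single_mul_single, MonoidAlgebra.smul_single, smul_eq_mul, mul_comm]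
      have e' := hg₀ g
      rw [mul_assoc] at e'
      rw [LinearMap.sub_apply, LinearMap.comp_apply, LinearMap.comp_apply, LinearMap.mulRight_apply,
        LinearMap.mulRight_apply, e, map_smul, greenBlock_single, greenBlock_single, greenProduct,
        greenProduct, mul_assoc, mul_assoc, e', mul_smul_comm, mul_assoc, sub_self]
      exact zero_mem _
    · exact ⟨0, fun i x => by simpa using greenBlock_mul_of_mem hπ hγ a D i j h x⟩

/-- The twisted monoid algebra as an iterated inflation of the group algebras of the
Schützenberger groups. -/
noncomputable def iteratedInflation : IteratedInflation k (TwistedMonoidAlgebra π) (DClass M)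
    (fun D => GreenRow (γ D)) (fun D => GreenCol (γ D))
    (fun D => MonoidAlgebra k (SchutzenbergerGroup (γ D))) where
  equiv := greenEquiv hπ hγ
  left := exists_left_action hπ hγ
  right := exists_right_action hπ hγ

/-- The four inner factors of a product of two basis elements are exactly those in `hg`; bilinearity
is then applied one variable at a time. The identity is exact, without higher terms. -/
theorem greenBlock_mul_greenBlock {D : DClass M} {i₀ : GreenRow (γ D)} {j₀ : GreenCol (γ D)} {c : k}
    {g₀ : SchutzenbergerGroup (γ D)} (hg : ∀ g h : SchutzenbergerGroup (γ D),
      of π (schutzPoint g) * of π j₀.mult * of π i₀.mult * of π (schutzPoint h) =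
        c • of π (schutzPoint (g * g₀ * h)))
    (i : GreenRow (γ D)) (j : GreenCol (γ D))
    (x y : MonoidAlgebra k (SchutzenbergerGroup (γ D))) :
    greenBlock hπ hγ D i j₀ x * greenBlock hπ hγ D i₀ j y =
      greenBlock hπ hγ D i j (x * (MonoidAlgebra.single g₀ c * y)) := by
  have hB : ∀ g h, greenProduct π i j₀ g * greenProduct π i₀ j h =
      c • greenProduct π i j (g * (g₀ * h)) := by
    intro g h
    calc greenProduct π i j₀ g * greenProduct π i₀ j h
        = of π i.mult * (of π (schutzPoint g) * of π j₀.mult * of π i₀.mult *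
            of π (schutzPoint h)) * of π j.mult := by
          simp only [greenProduct, mul_assoc]
      _ = _ := by rw [hg g h, mul_smul_comm, smul_mul_assoc, greenProduct, mul_assoc g]
  have h1 : ∀ g, greenProduct π i j₀ g * greenBlock hπ hγ D i₀ j y -
      greenBlock hπ hγ D i j (MonoidAlgebra.single g 1 * (MonoidAlgebra.single g₀ c * y)) = 0 := by
    intro g
    have h2 := LinearMap.forall_mem_of_single
      (LinearMap.mulLeft k (greenProduct π i j₀ g) ∘ₗ greenBlock hπ hγ D i₀ j -
        greenBlock hπ hγ D i j ∘ₗ LinearMap.mulLeft k (MonoidAlgebra.single g 1) ∘ₗ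
          LinearMap.mulLeft k (MonoidAlgebra.single g₀ c)) ⊥ (fun h => by
        have e : (MonoidAlgebra.single g 1 * (MonoidAlgebra.single g₀ c *
            MonoidAlgebra.single h 1) : MonoidAlgebra k (SchutzenbergerGroup (γ D))) =
            c • MonoidAlgebra.single (g * (g₀ * h)) 1 := by
          rw [MonoidAlgebra.single_mul_single, MonoidAlgebra.single_mul_single,
            MonoidAlgebra.smul_single, smul_eq_mul, one_mul]
        rw [Submodule.mem_bot, LinearMap.sub_apply, LinearMap.comp_apply, LinearMap.comp_apply,
          LinearMap.comp_apply, LinearMap.mulLeft_apply, LinearMap.mulLeft_apply,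
          LinearMap.mulLeft_apply, e, map_smul, greenBlock_single, greenBlock_single, hB,
          sub_self]) y
    rwa [Submodule.mem_bot, LinearMap.sub_apply, LinearMap.comp_apply, LinearMap.comp_apply,
      LinearMap.comp_apply, LinearMap.mulLeft_apply, LinearMap.mulLeft_apply,
      LinearMap.mulLeft_apply] at h2
  have h3 := LinearMap.forall_mem_of_single
    (LinearMap.mulRight k (greenBlock hπ hγ D i₀ j y) ∘ₗ greenBlock hπ hγ D i j₀ -
      greenBlock hπ hγ D i j ∘ₗ LinearMap.mulRight k (MonoidAlgebra.single g₀ c * y)) ⊥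
    (fun g => by
      rw [Submodule.mem_bot, LinearMap.sub_apply, LinearMap.comp_apply, LinearMap.comp_apply,
        LinearMap.mulRight_apply, LinearMap.mulRight_apply, greenBlock_single, h1]) x
  rwa [Submodule.mem_bot, LinearMap.sub_apply, LinearMap.comp_apply, LinearMap.comp_apply,
    LinearMap.mulRight_apply, LinearMap.mulRight_apply, sub_eq_zero] at h3

theorem _root_.MonoidAlgebra.isUnit_single {G : Type*} [Group G] (g : G) {c : k} (hc : c ≠ 0) :
    IsUnit (MonoidAlgebra.single g c) :=
  ⟨⟨_, MonoidAlgebra.single g⁻¹ c⁻¹,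
    by simp [MonoidAlgebra.single_mul_single, hc, MonoidAlgebra.one_def],
    by simp [MonoidAlgebra.single_mul_single, hc, MonoidAlgebra.one_def]⟩, rfl⟩

/-- Regularity enters only here, to find a nonzero sandwich entry; a nonzero multiple of a group
element is a unit. -/
theorem exists_unit_middle (hM : IsRegularMonoid M) (D : DClass M) :
    ∃ (i₀ : GreenRow (γ D)) (j₀ : GreenCol (γ D)) (p : MonoidAlgebra k (SchutzenbergerGroup (γ D))),
      IsUnit p ∧ ∀ i j x y,
        greenBlock hπ hγ D i j₀ x * greenBlock hπ hγ D i₀ j y =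
          greenBlock hπ hγ D i j (x * p * y) := by
  obtain ⟨i₀, j₀, h⟩ := hM.exists_greenD_mul (γ D)
  obtain ⟨c, g₀, hc, hg⟩ := hπ.exists_mul_middle i₀ j₀ h
  refine ⟨i₀, j₀, MonoidAlgebra.single g₀ c, MonoidAlgebra.isUnit_single g₀ hc,
    fun i j x y => ?_⟩
  rw [mul_assoc]
  exact greenBlock_mul_greenBlock hπ hγ hg i j x y

end TwistedMonoidAlgebra

end Inflation

theorem proposition5p4 {k : Type u} [Field k] {M : Type v} [Monoid M] [Finite M]
    (hM : IsRegularMonoid M)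
    (π : Twisting k M) (hπ : π.StronglyCompatible)
    (γ : DClass M → M) (hγ : ∀ D : DClass M, DClass.mk (γ D) = D)
    (S : ∀ D : DClass M, CellStructure.{w} k (MonoidAlgebra k (SchutzenbergerGroup (γ D))))
    (hS : ∀ D : DClass M, (S D).Λ₀ = Set.univ) :
    IsQuasiHereditary k (TwistedMonoidAlgebra π) := by
  have : Fintype (DClass M) := Fintype.ofFinite _
  refine (TwistedMonoidAlgebra.iteratedInflation hπ hγ).isQuasiHereditary S hS fun D => ?_
  obtain ⟨i₀, j₀, p, hp, h⟩ := TwistedMonoidAlgebra.exists_unit_middle hπ hγ hM D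
  refine ⟨i₀, j₀, p, hp, fun i j x y => ?_⟩
  have e := sub_eq_zero.2 (h i j x y)
  exact (congrArg (· ∈ IteratedInflation.higher _ D) e).mpr (zero_mem _)
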